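/- **Setting.** Let $k$ be a commutative Noetherian ring and let $\mathcal C$ be a small category such that: (i) all sets $\mathcal C(x,y)$ are finite; (ii) the relation "$x\leqslant y$ iff $\mathcal C(x,y)\neq\emptyset$" is a partial order on the objects; (iii) there is a rank function $|\cdot|:\operatorname{Ob}\mathcal C\to\mathbb N$ with $|x|\leqslant|y|$ whenever $x\leqslant y$ and $|y|=|x|+1$ whenever $y$ covers $x$; (iv) for every $n\in\mathbb N$ only finitely many objects have rank $n$ (a *locally finite, locally bounded graded category*). A *$\mathcal C$-module* is a functor $V:\mathcal C\to k\text{-}\mathrm{Mod}$, with values $V_x$; the *free module* at $x$ is $M(x)=k\mathcal C(x,-)$. $V$ is *finitely generated* if some finite set of elements of $\bigoplus_x V_x$ lies in no proper submodule, and $\mathcal C$ is *locally Noetherian over $k$* if submodules of finitely generated $\mathcal C$-modules are finitely generated. The *generating degree* $\operatorname{gd}(V)$ is the infimum of the $n\in\mathbb N$ such that no proper submodule of $V$ contains $\bigoplus_{|x|\leqslant n}V_x$ (so $\operatorname{gd}(V)=\infty$ if there is no such $n$), and $\operatorname{gd}(0)=-1$. An *inductive functor of multiplicity $d$* ($d$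 a positive integer) is an exact functor $F:\mathcal C\text{-}\mathrm{Mod}\to\mathcal C\text{-}\mathrm{Mod}$ with a natural transformation $\theta:\mathrm{Id}^{\oplus d}\to F$ such that for every object $x$ the module $FM(x)$ is finitely generated and $\theta_{M(x)}:M(x)^{\oplus d}\to FM(x)$ is injective, and such that $\operatorname{gd}(\operatorname{coker}\theta_V)=\operatorname{gd}(V)-1$ for every nonzero $\mathcal C$-module $V$. Let $k\mathcal C$ be the category algebra and $\mathfrak m=\bigoplus_{x<y}k\mathcal C(x,y)$, a two-sided ideal. For a $\mathcal C$-module $V$ and $i\geqslant0$ put $H_i(V)=\operatorname{Tor}_i^{k\mathcal C}(k\mathcal C/\mathfrak m,V)$, the $i$-th left derived functor of $k\mathcal C/\mathfrak m\otimes_{k\mathcal C}-$, which is again a $\mathcal C$-module. Let $\operatorname{hd}_i(V)=\sup\{|x| : H_i(V)_x\neq0\}$ if $H_i(V)\neq0$ and $\operatorname{hd}_i(V)=-1$ otherwise, and let the Castelnuovo–Mumford regularity be $\operatorname{reg}(V)=\sup\{\operatorname{hd}_i(V)-i : i\geqslant0\}\in\mathbb Z\cup\{\infty\}$. **Theorem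 1.2.** Let $\mathcal C$ be a locally finite, locally bounded graded category equipped with an inductive functor $F$ of multiplicity $d$, and let $k$ be a commutative Noetherian ring such that $\mathcal C$ is locally Noetherian over $k$. If $\operatorname{reg}(FM(x))\leqslant|x|$ for every object $x$ of $\mathcal C$, then $\operatorname{reg}(V)<\infty$ for every finitely generated $\mathcal C$-module $V$. -/

import Mathlib

open CategoryTheory CategoryTheory.Limits
open scoped TensorProduct DirectSum

universe u

/-- `x < y` in the order on objects for which `x ≤ y` means that there is a morphism `x ⟶ y`. -/
def ObjLT {C : Type u} [SmallCategory C] (x y : C) : Prop :=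
  x ≠ y ∧ Nonempty (x ⟶ y)

/-- `y` covers `x`: `x < y` and there is no object strictly between them. -/
def ObjCovers {C : Type u} [SmallCategory C] (x y : C) : Prop :=
  ObjLT x y ∧ ∀ z : C, ObjLT x z → ¬ ObjLT z y

/-- A locally finite, locally bounded graded category.  The relation `Nonempty (x ⟶ y)` is always
reflexive and transitive, so `directed` says precisely that it is a partial ordering. -/
class GradedCategory (C : Type u) [SmallCategory C] where
  /-- the rank function `x ↦ |x|` -/
  rank : C → ℕ
  locallyFinite : ∀ x y : C, Finite (x ⟶ y)
  directed : ∀ x y : C, Nonempty (x ⟶ y) → Nonempty (y ⟶ x) → x = y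
  rank_mono : ∀ x y : C, Nonempty (x ⟶ y) → rank x ≤ rank y
  rank_covers : ∀ x y : C, ObjCovers x y → rank y = rank x + 1
  locallyBounded : ∀ n : ℕ, {x : C | rank x = n}.Finite

namespace GradedCategory

noncomputable section

variable (k : Type u) [CommRing k] (C : Type u) [SmallCategory C]

/-- `C`-modules: covariant functors from `C` to `k`-modules. -/
abbrev CMod : Type (u + 1) := C ⥤ ModuleCat.{u} k

variable {C}

/-- The free module `M(x) = kC(x, -)`. -/
def freeMod (x : C) : CMod k C :=
  coyoneda.obj (Opposite.op x) ⋙ ModuleCat.free k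

variable {k}

/-- `V` is finitely generated: some finite set of (homogeneous) elements of `V` is contained in no
proper submodule; a submodule is given by a monomorphism into `V`. -/
def IsFG (V : CMod k C) : Prop :=
  ∃ S : Set (Σ x : C, V.obj x), S.Finite ∧
    ∀ (W : CMod k C) (i : W ⟶ V) [Mono i],
      (∀ s ∈ S, ∃ w : W.obj s.1, (i.app s.1).hom w = s.2) → IsIso i

variable (k C) in
/-- `C` is locally Noetherian over `k`: submodules of finitely generated modules are finitely
generated. -/
def LocallyNoetherian : Prop :=
  ∀ (V : CMod k C), IsFG V → ∀ (W : CMod k C) (i : W ⟶ V) [Mono i], IsFG W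

/-- The category of `C`-modules has enough projectives. -/
instance : EnoughProjectives (CMod k C) where
  presentation V := by
    let L (x : C) : CMod k C :=
      (evaluationLeftAdjoint (ModuleCat.{u} k) x).obj (Projective.over (V.obj x))
    let φ (x : C) : L x ⟶ V :=
      ((evaluationAdjunctionRight (ModuleCat.{u} k) x).homEquiv _ V).symm (Projective.π (V.obj x))
    have hL (x : C) : Projective (L x) :=
      (evaluationAdjunctionRight (ModuleCat.{u} k) x).map_projective _ inferInstance
    have hφ (x : C) : Epi ((φ x).app x) := by
      have h : (evaluationAdjunctionRight (ModuleCat.{u} k) x).homEquiv _ V (φ x) =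
          Projective.π (V.obj x) := Equiv.apply_symm_apply _ _
      rw [Adjunction.homEquiv_unit] at h
      have h' : Epi ((evaluationAdjunctionRight (ModuleCat.{u} k) x).unit.app _ ≫ (φ x).app x) := by
        change Epi (_ ≫ ((evaluation C (ModuleCat.{u} k)).obj x).map (φ x))
        rw [h]
        exact Projective.π_epi _
      exact epi_of_epi ((evaluationAdjunctionRight (ModuleCat.{u} k) x).unit.app _) _
    have (x : C) : Epi ((Sigma.desc φ).app x) := by
      have h : (Sigma.ι L x).app x ≫ (Sigma.desc φ).app x = (φ x).app x := by
        rw [← NatTrans.comp_app, Sigma.ι_desc]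
      have h' : Epi ((Sigma.ι L x).app x ≫ (Sigma.desc φ).app x) := by
        rw [h]
        exact hφ x
      exact epi_of_epi ((Sigma.ι L x).app x) _
    have hepi : Epi (Sigma.desc φ) := NatTrans.epi_of_epi_app _
    exact ⟨{ p := ∐ L, f := Sigma.desc φ }⟩

section Degree

variable [GradedCategory C]

/-- `V` is generated in degrees `≤ n`: no proper submodule contains `V_x` for all `|x| ≤ n`. -/
def GeneratedInDegrees (V : CMod k C) (n : ℕ) : Prop :=
  ∀ (W : CMod k C) (i : W ⟶ V) [Mono i],
    (∀ x : C, rank x ≤ n → Function.Surjective (i.app x).hom) → IsIso i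

open Classical in
/-- The generating degree; it is `-1` for the zero module, and `⊤` if `V` is not generated in
degrees `≤ n` for any `n`. -/
def gd (V : CMod k C) : EReal :=
  if IsZero V then -1 else ⨅ (n : ℕ) (_ : GeneratedInDegrees V n), (n : EReal)

end Degree

section InductiveFunctor

instance : HasFiniteBiproducts (CMod k C) := Abelian.hasFiniteBiproducts

variable (k C) in
/-- The functor `Id^{⊕ d}`. -/
def idCopies (d : ℕ) : CMod k C ⥤ CMod k C where
  obj V := ⨁ fun _ : Fin d => V
  map f := biproduct.map fun _ => f

variable (k C) in
/-- An inductive functor of multiplicity `d`. -/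
structure InductiveFunctor [GradedCategory C] (d : ℕ) where
  F : CMod k C ⥤ CMod k C
  preservesFiniteLimits : PreservesFiniteLimits F
  preservesFiniteColimits : PreservesFiniteColimits F
  d_pos : 0 < d
  θ : idCopies k C d ⟶ F
  isFG_free : ∀ x : C, IsFG (F.obj (freeMod k x))
  mono_free : ∀ x : C, Mono (θ.app (freeMod k x))
  gd_cokernel : ∀ V : CMod k C, ¬ IsZero V → gd (cokernel (θ.app V)) = gd V - 1

end InductiveFunctor

/-! ### The category algebra modulo the ideal `m`

The category algebra is `kC = ⨁ kC(y, x)`, and the two-sided ideal `m` is spanned by the morphisms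
`y ⟶ x` with `y < x`.  Everything is written componentwise. -/

section Quotient

variable (k) in
/-- The component `m(y, x)` of the ideal `m` in `kC(y, x)`. -/
def ideal (y x : C) : Submodule k ((y ⟶ x) →₀ k) :=
  Submodule.span k {a | ObjLT y x ∧ ∃ f : y ⟶ x, a = Finsupp.single f 1}

variable (k) in
/-- The component of `kC / m` at `(y, x)`. -/
def AlgQuot (y x : C) : Type u := ((y ⟶ x) →₀ k) ⧸ ideal k y x

instance (y x : C) : AddCommGroup (AlgQuot k y x) :=
  inferInstanceAs (AddCommGroup (((y ⟶ x) →₀ k) ⧸ ideal k y x))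

instance (y x : C) : Module k (AlgQuot k y x) :=
  inferInstanceAs (Module k (((y ⟶ x) →₀ k) ⧸ ideal k y x))

variable (k) in
/-- The projection `kC(y, x) → (kC / m)(y, x)`. -/
def algMk (y x : C) : ((y ⟶ x) →₀ k) →ₗ[k] AlgQuot k y x := (ideal k y x).mkQ

theorem algQuot_ext {y x : C} {N : Type u} [AddCommGroup N] [Module k N]
    {φ ψ : AlgQuot k y x →ₗ[k] N}
    (h : ∀ f : y ⟶ x, φ (algMk k y x (Finsupp.single f 1)) = ψ (algMk k y x (Finsupp.single f 1))) :
    φ = ψ :=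
  Submodule.linearMap_qext (ideal k y x)
    (Finsupp.lhom_ext' fun f => LinearMap.ext_ring (h f))

variable [GradedCategory C]

theorem ideal_le_left (y : C) {x x' : C} (g : x ⟶ x') :
    ideal k y x ≤ (ideal k y x').comap (Finsupp.lmapDomain k k fun f : y ⟶ x => f ≫ g) := by
  refine Submodule.span_le.2 ?_
  rintro _ ⟨⟨hne, hf⟩, f, rfl⟩
  refine Submodule.subset_span ⟨⟨?_, ⟨f ≫ g⟩⟩, f ≫ g, by simp⟩
  rintro rfl
  exact hne (directed _ _ ⟨f⟩ ⟨g⟩)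

theorem ideal_le_right {y y' : C} (g : y' ⟶ y) (x : C) :
    ideal k y x ≤ (ideal k y' x).comap (Finsupp.lmapDomain k k fun f : y ⟶ x => g ≫ f) := by
  refine Submodule.span_le.2 ?_
  rintro _ ⟨⟨hne, hf⟩, f, rfl⟩
  refine Submodule.subset_span ⟨⟨?_, ⟨g ≫ f⟩⟩, g ≫ f, by simp⟩
  rintro rfl
  exact hne (directed _ _ ⟨f⟩ ⟨g⟩)

variable (k) in
/-- The left action of a morphism `g` of `C` on `kC / m`. -/
def quotLeft (y : C) {x x' : C} (g : x ⟶ x') : AlgQuot k y x →ₗ[k] AlgQuot k y x' :=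
  Submodule.mapQ (ideal k y x) (ideal k y x') _ (ideal_le_left y g)

variable (k) in
/-- The right action of a morphism `g` of `C` on `kC / m`. -/
def quotRight {y y' : C} (g : y' ⟶ y) (x : C) : AlgQuot k y x →ₗ[k] AlgQuot k y' x :=
  Submodule.mapQ (ideal k y x) (ideal k y' x) _ (ideal_le_right g x)

theorem quotLeft_mk (y : C) {x x' : C} (g : x ⟶ x') (f : y ⟶ x) :
    quotLeft k y g (algMk k y x (Finsupp.single f 1)) =
      algMk k y x' (Finsupp.single (f ≫ g) 1) :=
  congrArg (algMk k y x') (Finsupp.mapDomain_single (f := fun f : y ⟶ x => f ≫ g))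

theorem quotRight_mk {y y' : C} (g : y' ⟶ y) (x : C) (f : y ⟶ x) :
    quotRight k g x (algMk k y x (Finsupp.single f 1)) =
      algMk k y' x (Finsupp.single (g ≫ f) 1) :=
  congrArg (algMk k y' x) (Finsupp.mapDomain_single (f := fun f : y ⟶ x => g ≫ f))

theorem quotLeft_id (y x : C) : quotLeft k y (𝟙 x) = LinearMap.id := by
  refine algQuot_ext fun f => ?_
  simp [quotLeft_mk]

theorem quotLeft_comp (y : C) {x x' x'' : C} (g : x ⟶ x') (g' : x' ⟶ x'') :
    quotLeft k y (g ≫ g') = quotLeft k y g' ∘ₗ quotLeft k y g := by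
  refine algQuot_ext fun f => ?_
  simp [quotLeft_mk]

theorem quotLeft_quotRight {y y' x x' : C} (f : y' ⟶ y) (g : x ⟶ x') (q : AlgQuot k y x) :
    quotLeft k y' g (quotRight k f x q) = quotRight k f x' (quotLeft k y g q) := by
  suffices quotLeft k y' g ∘ₗ quotRight k f x = quotRight k f x' ∘ₗ quotLeft k y g from
    LinearMap.congr_fun this q
  refine algQuot_ext fun h => ?_
  simp [quotLeft_mk, quotRight_mk]

end Quotient

/-! ### The functor `kC / m ⊗_{kC} -` and its left derived functors -/

section Homology

variable [GradedCategory C]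

/-- The `k`-module `(kC / m)(y, x) ⊗_k V_y`. -/
abbrev Summand (V : CMod k C) (y x : C) : Type u := AlgQuot k y x ⊗[k] V.obj y

open Classical in
/-- The relations `q f ⊗ v = q ⊗ f v` (for `f` a morphism of `C`) that define the tensor product
over `kC`, in the part of the tensor product over `k` lying over the object `x`. -/
def tensorRel (V : CMod k C) (x : C) : Submodule k (⨁ y : C, Summand V y x) :=
  Submodule.span k {t | ∃ (y' y : C) (f : y' ⟶ y) (q : AlgQuot k y x) (v : V.obj y'),
    t = DirectSum.lof k C (fun y => Summand V y x) y' (quotRight k f x q ⊗ₜ[k] v) -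
      DirectSum.lof k C (fun y => Summand V y x) y (q ⊗ₜ[k] (V.map f).hom v)}

/-- The value of `kC / m ⊗_{kC} V` at `x`. -/
abbrev TensorAt (V : CMod k C) (x : C) : Type u :=
  (⨁ y : C, Summand V y x) ⧸ tensorRel V x

theorem tensorRel_le_left (V : CMod k C) {x x' : C} (g : x ⟶ x') :
    tensorRel V x ≤ (tensorRel V x').comap
      (DirectSum.lmap (M := fun y => Summand V y x) (N := fun y => Summand V y x')
        fun y => (quotLeft k y g).rTensor (V.obj y)) := by
  classical
  refine Submodule.span_le.2 ?_
  rintro _ ⟨y', y, f, q, v, rfl⟩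
  refine Submodule.subset_span ⟨y', y, f, quotLeft k y g q, v, ?_⟩
  simp [DirectSum.lmap_lof, quotLeft_quotRight]

theorem tensorRel_le_map {V W : CMod k C} (η : V ⟶ W) (x : C) :
    tensorRel V x ≤ (tensorRel W x).comap
      (DirectSum.lmap (M := fun y => Summand V y x) (N := fun y => Summand W y x)
        fun y => (η.app y).hom.lTensor (AlgQuot k y x)) := by
  classical
  refine Submodule.span_le.2 ?_
  rintro _ ⟨y', y, f, q, v, rfl⟩
  refine Submodule.subset_span ⟨y', y, f, q, (η.app y').hom v, ?_⟩
  have h : (η.app y).hom ((V.map f).hom v) = (W.map f).hom ((η.app y').hom v) :=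
    NatTrans.naturality_apply η f v
  simp [DirectSum.lmap_lof, h]

/-- The left action of a morphism of `C` on `kC / m ⊗_{kC} V`. -/
def tensorLeft (V : CMod k C) {x x' : C} (g : x ⟶ x') : TensorAt V x →ₗ[k] TensorAt V x' :=
  Submodule.mapQ _ _ _ (tensorRel_le_left V g)

/-- The map `kC / m ⊗_{kC} V → kC / m ⊗_{kC} W` induced by `η : V ⟶ W`, at the object `x`. -/
def tensorMap {V W : CMod k C} (η : V ⟶ W) (x : C) : TensorAt V x →ₗ[k] TensorAt W x :=
  Submodule.mapQ _ _ _ (tensorRel_le_map η x)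

open Classical in
theorem tensorAt_ext {V : CMod k C} {x : C} {N : Type u} [AddCommGroup N] [Module k N]
    {φ ψ : TensorAt V x →ₗ[k] N}
    (h : ∀ (y : C) (q : AlgQuot k y x) (v : V.obj y),
      φ (Submodule.Quotient.mk (DirectSum.lof k C (fun y => Summand V y x) y
        (q ⊗ₜ[k] v))) =
      ψ (Submodule.Quotient.mk (DirectSum.lof k C (fun y => Summand V y x) y
        (q ⊗ₜ[k] v)))) : φ = ψ :=
  Submodule.linearMap_qext _ (DirectSum.linearMap_ext k fun y => TensorProduct.ext' fun q v =>
    h y q v)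

open Classical in
theorem tensorLeft_mk (V : CMod k C) {x x' : C} (g : x ⟶ x') (y : C) (q : AlgQuot k y x)
    (v : V.obj y) :
    tensorLeft V g (Submodule.Quotient.mk (DirectSum.lof k C (fun y => Summand V y x) y
        (q ⊗ₜ[k] v))) =
      Submodule.Quotient.mk (DirectSum.lof k C (fun y => Summand V y x') y
        (quotLeft k y g q ⊗ₜ[k] v)) := by
  simp [tensorLeft, DirectSum.lmap_lof]

open Classical in
theorem tensorMap_mk {V W : CMod k C} (η : V ⟶ W) {x : C} (y : C) (q : AlgQuot k y x)
    (v : V.obj y) :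
    tensorMap η x (Submodule.Quotient.mk (DirectSum.lof k C (fun y => Summand V y x) y
        (q ⊗ₜ[k] v))) =
      Submodule.Quotient.mk (DirectSum.lof k C (fun y => Summand W y x) y
        (q ⊗ₜ[k] (η.app y).hom v)) := by
  simp [tensorMap, DirectSum.lmap_lof]

theorem tensorLeft_id (V : CMod k C) (x : C) : tensorLeft V (𝟙 x) = LinearMap.id :=
  tensorAt_ext fun y q v => by simp [tensorLeft_mk, quotLeft_id]

theorem tensorLeft_comp (V : CMod k C) {x x' x'' : C} (g : x ⟶ x') (g' : x' ⟶ x'') :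
    tensorLeft V (g ≫ g') = tensorLeft V g' ∘ₗ tensorLeft V g :=
  tensorAt_ext fun y q v => by simp [tensorLeft_mk, quotLeft_comp]

theorem tensorMap_id (V : CMod k C) (x : C) : tensorMap (𝟙 V) x = LinearMap.id :=
  tensorAt_ext fun y q v => by simp [tensorMap_mk]

theorem tensorMap_comp {U V W : CMod k C} (η : U ⟶ V) (η' : V ⟶ W) (x : C) :
    tensorMap (η ≫ η') x = tensorMap η' x ∘ₗ tensorMap η x :=
  tensorAt_ext fun y q v => by simp [tensorMap_mk]

theorem tensorMap_add {V W : CMod k C} (η η' : V ⟶ W) (x : C) :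
    tensorMap (η + η') x = tensorMap η x + tensorMap η' x :=
  tensorAt_ext fun y q v => by simp [tensorMap_mk, TensorProduct.tmul_add]

theorem tensorMap_tensorLeft {V W : CMod k C} (η : V ⟶ W) {x x' : C} (g : x ⟶ x') :
    tensorMap η x' ∘ₗ tensorLeft V g = tensorLeft W g ∘ₗ tensorMap η x :=
  tensorAt_ext fun y q v => by simp [tensorMap_mk, tensorLeft_mk]

/-- The `C`-module `kC / m ⊗_{kC} V`. -/
def tensorObj (V : CMod k C) : CMod k C where
  obj x := ModuleCat.of k (TensorAt V x)
  map g := ModuleCat.ofHom (tensorLeft V g)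
  map_id x := ModuleCat.hom_ext (tensorLeft_id V x)
  map_comp g g' := ModuleCat.hom_ext (tensorLeft_comp V g g')

variable (k C) in
/-- The functor `kC / m ⊗_{kC} -` on `C`-modules. -/
def tensorFunctor : CMod k C ⥤ CMod k C where
  obj V := tensorObj V
  map η :=
    { app := fun x => ModuleCat.ofHom (tensorMap η x)
      naturality := fun _ _ g => ModuleCat.hom_ext (tensorMap_tensorLeft η g) }
  map_id V := NatTrans.ext (funext fun x => ModuleCat.hom_ext (tensorMap_id V x))
  map_comp η η' := NatTrans.ext (funext fun x => ModuleCat.hom_ext (tensorMap_comp η η' x))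

instance : (tensorFunctor k C).Additive where
  map_add {_ _ η η'} := NatTrans.ext (funext fun x => ModuleCat.hom_ext (tensorMap_add η η' x))

/-- The homology `H_i(V) = Tor_i^{kC}(kC / m, V)`. -/
def homology (i : ℕ) (V : CMod k C) : CMod k C :=
  ((tensorFunctor k C).leftDerived i).obj V

open Classical in
/-- The `i`-th homological degree. -/
def hd (i : ℕ) (V : CMod k C) : EReal :=
  if IsZero (homology i V) then -1
  else ⨆ (x : C) (_ : ¬ IsZero ((homology i V).obj x)), (rank x : EReal)

/-- The Castelnuovo–Mumford regularity. -/
def reg (V : CMod k C) : EReal :=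
  ⨆ i : ℕ, hd i V - (i : EReal)

end Homology

end

end GradedCategory

/-! Regularity is traded for vanishing of extensions. `ExtVanish V c` requires `Ext^i(V, S) = 0`
whenever `S` vanishes in ranks `< c + i`; by `extVanish_of_reg_le` and `ExtVanish.reg_lt_top`,
finite regularity amounts to `ExtVanish V c` for some `c`. Call such `V` bounded. Long exact
sequences of Ext carry this property through short exact sequences, with the usual shifts.

The proof (`exists_extVanish`) is an induction on the ranks in which `V` is generated, with a
Noetherian induction inside it, so that proper quotients of `V` may be assumed bounded. Split `θ`
into `d` components `θ_j : V ⟶ FV`, and take `J` maximal such that the `θ_j` with `j ∈ J` embed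
`V^J` into `FV`. The quotient of `FV` by the images of all components is generated in smaller ranks,
hence is bounded. Now drop the indices outside `J` one at a time: each time the kernel that appears
is the image of `V` under a map that is not injective, by maximality of `J`. It is a proper quotient
of `V`, hence bounded. So `I.coker J V` is bounded (`exists_extVanish_coker`).

To return from `I.coker J V` to `V` (`ext_eq_zero_of_good`), cover `V` by a finite free module `P`
with kernel `Z`. Injectivity on `V^J` makes `0 → coker_J Z → coker_J P → coker_J V → 0` exact
(`shortExact_coker`), and the hypothesis on `FM(x)` controls the middle term. Thus `coker_J Z` is
bounded, and since the cokernel of `θ` lowers the generating degree by exactly one, so is the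
generating degree of `Z`. As `Z` is finitely generated and inherits injectivity from `P`, the
argument repeats along all syzygies, each step costing one rank. -/

open scoped ZeroObject

namespace GradedCategory

noncomputable section

variable {k : Type u} [CommRing k] {C : Type u} [SmallCategory C]

/-! ### Pointwise criteria in the category of `C`-modules -/

theorem mono_iff_injective {V W : CMod k C} (f : V ⟶ W) :
    Mono f ↔ ∀ x, Function.Injective (f.app x).hom := by
  rw [NatTrans.mono_iff_mono_app]
  exact forall_congr' fun x => ModuleCat.mono_iff_injective _

theorem epi_iff_surjective {V W : CMod k C} (f : V ⟶ W) :
    Epi f ↔ ∀ x, Function.Surjective (f.app x).hom := by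
  rw [NatTrans.epi_iff_epi_app]
  exact forall_congr' fun x => ModuleCat.epi_iff_surjective _

theorem map_app_hom {V W : CMod k C} (f : V ⟶ W) {x y : C} (g : x ⟶ y) (v : V.obj x) :
    (f.app y).hom ((V.map g).hom v) = (W.map g).hom ((f.app x).hom v) :=
  NatTrans.naturality_apply f g v

theorem hom_eq_zero_iff {V W : CMod k C} (f : V ⟶ W) :
    f = 0 ↔ ∀ x (v : V.obj x), (f.app x).hom v = 0 := by
  constructor
  · rintro rfl x v
    rfl
  · intro h
    ext x v
    exact h x v

theorem isZero_obj_of_epi {V S : CMod k C} (f : V ⟶ S) [Epi f] (x : C)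
    (h : ∀ v : V.obj x, (f.app x).hom v = 0) : IsZero (S.obj x) := by
  rw [ModuleCat.isZero_iff_subsingleton]
  refine subsingleton_of_forall_eq 0 fun w => ?_
  obtain ⟨v, rfl⟩ := (epi_iff_surjective f).1 inferInstance x w
  exact h v

theorem shortExact_of_pointwise (S : ShortComplex (CMod k C))
    (hf : ∀ x, Function.Injective (S.f.app x).hom)
    (hg : ∀ x, Function.Surjective (S.g.app x).hom)
    (hfg : ∀ x (v : S.X₂.obj x), (S.g.app x).hom v = 0 → ∃ w, (S.f.app x).hom w = v) :
    S.ShortExact := by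
  have : Mono S.f := (mono_iff_injective _).2 hf
  have : Epi S.g := (epi_iff_surjective _).2 hg
  refine ⟨?_⟩
  rw [ShortComplex.exact_iff_isZero_homology, Functor.isZero_iff]
  intro x
  refine IsZero.of_iso ?_ (S.mapHomologyIso ((evaluation C (ModuleCat.{u} k)).obj x)).symm
  rw [← ShortComplex.exact_iff_isZero_homology, ShortComplex.moduleCat_exact_iff]
  exact hfg x

theorem ShortExact.injective {S : ShortComplex (CMod k C)} (hS : S.ShortExact) (x : C) :
    Function.Injective (S.f.app x).hom :=
  (mono_iff_injective _).1 hS.mono_f x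

theorem ShortExact.surjective {S : ShortComplex (CMod k C)} (hS : S.ShortExact) (x : C) :
    Function.Surjective (S.g.app x).hom :=
  (epi_iff_surjective _).1 hS.epi_g x

theorem ShortExact.exists_of_eq_zero {S : ShortComplex (CMod k C)} (hS : S.ShortExact) (x : C)
    (v : S.X₂.obj x) (hv : (S.g.app x).hom v = 0) : ∃ w, (S.f.app x).hom w = v :=
  (ShortComplex.moduleCat_exact_iff _).1
    (hS.map_of_exact ((evaluation C (ModuleCat.{u} k)).obj x)).exact v hv

theorem ShortExact.zero_apply (S : ShortComplex (CMod k C)) (x : C) (v : S.X₁.obj x) :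
    (S.g.app x).hom ((S.f.app x).hom v) = 0 :=
  (hom_eq_zero_iff _).1 S.zero x v

instance : HasExt.{u} (CMod k C) := hasExt_of_enoughProjectives _

theorem shortExact_kernel {A : Type*} [Category* A] [Abelian A] {V W : A} (f : V ⟶ W) [Epi f] :
    (ShortComplex.mk (kernel.ι f) f (kernel.condition f)).ShortExact :=
  { exact := ShortComplex.exact_of_f_is_kernel _ (kernelIsKernel f) }

/-! ### Submodules and quotients -/

variable (V : CMod k C)

/-- A submodule of `V`, given by its components. -/
@[ext]
structure SubMod where
  carrier : ∀ x, Submodule k (V.obj x)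
  map_mem : ∀ {x y : C} (g : x ⟶ y) (v : V.obj x), v ∈ carrier x → (V.map g).hom v ∈ carrier y

variable {V}

namespace SubMod

instance : PartialOrder (SubMod V) :=
  PartialOrder.lift carrier fun _ _ h => SubMod.ext h

variable (N : SubMod V)

/-- A submodule as a `C`-module. -/
def toMod : CMod k C where
  obj x := ModuleCat.of k (N.carrier x)
  map g := ModuleCat.ofHom ((V.map g).hom.restrict fun v hv => N.map_mem g v hv)
  map_id x := by
    ext v
    change (V.map (𝟙 x)).hom v.1 = v.1
    simp
  map_comp g h := by
    ext v
    change (V.map (g ≫ h)).hom v.1 = (V.map h).hom ((V.map g).hom v.1)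
    simp

/-- The inclusion of a submodule. -/
def ι : N.toMod ⟶ V where
  app x := ModuleCat.ofHom (N.carrier x).subtype

instance : Mono N.ι := (mono_iff_injective _).2 fun _ => Subtype.val_injective

/-- The quotient by a submodule. -/
def quot : CMod k C where
  obj x := ModuleCat.of k (V.obj x ⧸ N.carrier x)
  map g := ModuleCat.ofHom (Submodule.mapQ _ _ (V.map g).hom fun v hv => N.map_mem g v hv)
  map_id x := by ext v; simp
  map_comp g h := by ext v; simp

/-- The projection to the quotient. -/
def π : V ⟶ N.quot where
  app x := ModuleCat.ofHom (N.carrier x).mkQ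

theorem π_surjective (x : C) : Function.Surjective (N.π.app x).hom :=
  Submodule.mkQ_surjective _

theorem π_eq_zero_iff {x : C} (v : V.obj x) : (N.π.app x).hom v = 0 ↔ v ∈ N.carrier x :=
  Submodule.Quotient.mk_eq_zero _

instance : Epi N.π := (epi_iff_surjective _).2 N.π_surjective

/-- The universal property of the quotient. -/
def desc {W : CMod k C} (f : V ⟶ W) (h : ∀ x, ∀ v ∈ N.carrier x, (f.app x).hom v = 0) :
    N.quot ⟶ W where
  app x := ModuleCat.ofHom (Submodule.liftQ _ (f.app x).hom fun v hv => h x v hv)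
  naturality x y g := by
    ext v
    obtain ⟨v, rfl⟩ := N.π_surjective x v
    exact map_app_hom f g v

theorem isZero_quot_iff (x : C) : IsZero (N.quot.obj x) ↔ N.carrier x = ⊤ := by
  rw [ModuleCat.isZero_iff_subsingleton]
  exact Submodule.Quotient.subsingleton_iff

/-- The kernel of a morphism. -/
def ker {W : CMod k C} (f : V ⟶ W) : SubMod V where
  carrier x := LinearMap.ker (f.app x).hom
  map_mem g v hv := by
    rw [LinearMap.mem_ker] at hv ⊢
    rw [map_app_hom, hv, map_zero]

theorem mem_ker {W : CMod k C} (f : V ⟶ W) {x : C} (v : V.obj x) :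
    v ∈ (ker f).carrier x ↔ (f.app x).hom v = 0 := Iff.rfl

/-- The submodule generated by a set of homogeneous elements. -/
def gen (S : Set (Σ x : C, V.obj x)) : SubMod V where
  carrier x := Submodule.span k {v | ∃ s ∈ S, ∃ g : s.1 ⟶ x, v = (V.map g).hom s.2}
  map_mem {x y} g v hv := by
    refine Submodule.span_induction (p := fun v _ => (V.map g).hom v ∈ Submodule.span k
      {v | ∃ s ∈ S, ∃ g : s.1 ⟶ y, v = (V.map g).hom s.2}) ?_ (by simp) ?_ ?_ hv
    · rintro _ ⟨s, hs, h, rfl⟩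
      exact Submodule.subset_span ⟨s, hs, h ≫ g, by simp⟩
    · intro a b _ _ ha hb
      rw [map_add]
      exact add_mem ha hb
    · intro a b _ hb
      rw [map_smul]
      exact Submodule.smul_mem _ _ hb

theorem subset_gen {S : Set (Σ x : C, V.obj x)} {s : Σ x : C, V.obj x} (hs : s ∈ S) :
    s.2 ∈ (gen S).carrier s.1 :=
  Submodule.subset_span ⟨s, hs, 𝟙 _, by simp⟩

theorem gen_le {S : Set (Σ x : C, V.obj x)} (h : ∀ s ∈ S, s.2 ∈ N.carrier s.1) : gen S ≤ N := by
  intro x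
  refine Submodule.span_le.2 ?_
  rintro _ ⟨s, hs, g, rfl⟩
  exact N.map_mem g _ (h s hs)

end SubMod

/-! ### Finite generation -/

/-- Submodules are kernels and monomorphisms have cokernels, so generation can be tested on
morphisms out of `V`. This form passes readily to quotients and extensions. -/
theorem isFG_iff : IsFG V ↔ ∃ S : Set (Σ x : C, V.obj x), S.Finite ∧
    ∀ (W : CMod k C) (f : V ⟶ W), (∀ s ∈ S, (f.app s.1).hom s.2 = 0) → f = 0 := by
  refine exists_congr fun S => and_congr_right fun _ => ⟨fun h W f hf => ?_, fun h W i _ hi => ?_⟩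
  · have := h _ (SubMod.ker f).ι fun s hs => ⟨⟨s.2, hf s hs⟩, rfl⟩
    rw [← cancel_epi (SubMod.ker f).ι, comp_zero, hom_eq_zero_iff]
    exact fun x v => v.2
  · have h0 : cokernel.π i = 0 := h _ _ fun s hs => by
      obtain ⟨w, hw⟩ := hi s hs
      rw [← hw]
      exact (hom_eq_zero_iff _).1 (cokernel.condition i) _ w
    have : Epi i := Preadditive.epi_of_cokernel_zero (by simpa using h0)
    exact isIso_of_mono_of_epi i

theorem IsFG.of_epi {V W : CMod k C} (hV : IsFG V) (f : V ⟶ W) [Epi f] : IsFG W := by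
  rw [isFG_iff] at hV ⊢
  obtain ⟨S, hS, h⟩ := hV
  refine ⟨Set.image (fun s => ⟨s.1, (f.app s.1).hom s.2⟩) S, hS.image _, fun U g hg => ?_⟩
  rw [← cancel_epi f, comp_zero]
  exact h _ _ fun s hs => hg _ ⟨s, hs, rfl⟩

theorem IsFG.of_shortExact {S : ShortComplex (CMod k C)} (hS : S.ShortExact) (h₁ : IsFG S.X₁)
    (h₃ : IsFG S.X₃) : IsFG S.X₂ := by
  rw [isFG_iff] at h₁ h₃ ⊢
  obtain ⟨A, hA, h₁⟩ := h₁
  obtain ⟨B, hB, h₃⟩ := h₃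
  have := hS.mono_f
  have := hS.epi_g
  choose l hl using ShortExact.surjective hS
  refine ⟨Set.image (fun s => ⟨s.1, (S.f.app s.1).hom s.2⟩) A ∪
      Set.image (fun s => ⟨s.1, l s.1 s.2⟩) B,
    (hA.image _).union (hB.image _), fun U g hg => ?_⟩
  have hf : S.f ≫ g = 0 := h₁ _ _ fun s hs => hg _ (Or.inl ⟨s, hs, rfl⟩)
  have hd : S.g ≫ hS.exact.desc g hf = g := hS.exact.g_desc g hf
  have h0 : hS.exact.desc g hf = 0 := h₃ _ _ fun s hs => by
    have := hg _ (Or.inr ⟨s, hs, rfl⟩)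
    rw [← hd] at this
    rw [← hl s.1 s.2]
    exact this
  rw [← hd, h0, comp_zero]

theorem IsFG.of_isZero (h : IsZero V) : IsFG V :=
  isFG_iff.2 ⟨∅, Set.finite_empty, fun _ _ _ => h.eq_of_src _ _⟩

/-- The union of an ascending chain is a finitely generated submodule; its generators already lie in
one term of the chain, and the chain is constant from there on. -/
theorem wellFoundedGT_subMod (hN : LocallyNoetherian k C) (hV : IsFG V) :
    WellFoundedGT (SubMod V) := by
  rw [wellFoundedGT_iff_monotone_chain_condition]
  intro a
  have hdir (x : C) : Directed (· ≤ ·) fun n => (a n).carrier x := fun i j =>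
    ⟨max i j, a.monotone (le_max_left i j) x, a.monotone (le_max_right i j) x⟩
  let U : SubMod V :=
    { carrier := fun x => ⨆ n, (a n).carrier x
      map_mem := fun {x y} g v hv => by
        rw [Submodule.mem_iSup_of_directed _ (hdir _)] at hv ⊢
        obtain ⟨n, hn⟩ := hv
        exact ⟨n, (a n).map_mem g v hn⟩ }
  obtain ⟨S, hS, h⟩ := isFG_iff.1 (hN V hV U.toMod U.ι)
  have hmem (s : Σ x : C, U.toMod.obj x) : ∃ n, (s.2.1 : V.obj s.1) ∈ (a n).carrier s.1 :=
    (Submodule.mem_iSup_of_directed _ (hdir _)).1 s.2.2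
  choose m hm using hmem
  obtain ⟨n, hn⟩ := (hS.image m).bddAbove
  have h0 : U.ι ≫ (a n).π = 0 := h _ _ fun s hs => by
    refine ((a n).π_eq_zero_iff _).2 ?_
    exact a.monotone (hn ⟨s, hs, rfl⟩) _ (hm s)
  refine ⟨n, fun j hj => le_antisymm (a.monotone hj) fun x v hv => ?_⟩
  exact ((a n).π_eq_zero_iff v).1 ((hom_eq_zero_iff _).1 h0 x
    ⟨v, (Submodule.mem_iSup_of_directed _ (hdir _)).2 ⟨j, hv⟩⟩)

/-! ### Free modules -/

variable (k) in
/-- The generator of the free module `M(x)`. -/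
def freeGen (x : C) : (freeMod k x).obj x := ModuleCat.freeMk (𝟙 x)

theorem freeMod_map_freeGen {x y : C} (f : x ⟶ y) :
    ((freeMod k x).map f).hom (freeGen k x) = ModuleCat.freeMk f := by
  refine (ModuleCat.free_map_apply _ _).trans ?_
  simp

theorem freeMod_hom_ext {x : C} {f g : freeMod k x ⟶ V}
    (h : (f.app x).hom (freeGen k x) = (g.app x).hom (freeGen k x)) : f = g := by
  refine NatTrans.ext (funext fun y => ModuleCat.free_hom_ext fun a => ?_)
  have := freeMod_map_freeGen (k := k) a
  change (f.app y).hom _ = (g.app y).hom _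
  rw [← this, map_app_hom, map_app_hom, h]

/-- The morphism `M(x) ⟶ V` determined by an element of `V_x`. -/
def freeLift {x : C} (v : V.obj x) : freeMod k x ⟶ V where
  app y := ModuleCat.freeDesc (↾fun f : x ⟶ y => (V.map f).hom v)
  naturality y z g := by
    refine ModuleCat.free_hom_ext fun a => ?_
    change (ModuleCat.freeDesc _).hom (((ModuleCat.free k).map _).hom (ModuleCat.freeMk a)) =
      (V.map g).hom ((ModuleCat.freeDesc _).hom (ModuleCat.freeMk a))
    erw [ModuleCat.free_map_apply, ModuleCat.freeDesc_apply, ModuleCat.freeDesc_apply]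
    simp

theorem freeLift_freeGen {x : C} (v : V.obj x) :
    ((freeLift v).app x).hom (freeGen k x) = v := by
  refine (ModuleCat.freeDesc_apply _ _).trans ?_
  simp

instance (x : C) : Projective (freeMod k x) where
  factors f e _ := by
    obtain ⟨v, hv⟩ := (epi_iff_surjective e).1 inferInstance x ((f.app x).hom (freeGen k x))
    refine ⟨freeLift v, freeMod_hom_ext ?_⟩
    rw [← hv]
    exact congrArg (e.app x).hom (freeLift_freeGen v)

theorem isFG_freeMod (x : C) : IsFG (freeMod k x) := by
  refine isFG_iff.2 ⟨{⟨x, freeGen k x⟩}, Set.finite_singleton _, fun W f hf => ?_⟩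
  exact freeMod_hom_ext (hf _ rfl)

end

end GradedCategory

namespace GradedCategory

noncomputable section

variable {k : Type u} [CommRing k] {C : Type u} [SmallCategory C] [GradedCategory C]

/-! ### Generation in small ranks -/

/-- `S` vanishes at all objects of rank `< n`. -/
def VanishLT (S : CMod k C) (n : ℕ) : Prop := ∀ x, rank x < n → IsZero (S.obj x)

theorem VanishLT.mono {S : CMod k C} {m n : ℕ} (h : VanishLT S n) (hmn : m ≤ n) : VanishLT S m :=
  fun x hx => h x (hx.trans_le hmn)

theorem VanishLT.eq_zero {S : CMod k C} {n : ℕ} (h : VanishLT S n) {x : C} (hx : rank x < n)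
    (v : S.obj x) : v = 0 :=
  (ModuleCat.isZero_iff_subsingleton.1 (h x hx)).elim _ _

/-- `V` is generated by its components of rank `< n`, expressed by the morphisms out of `V`. -/
def GenLT (V : CMod k C) (n : ℕ) : Prop := ∀ S, VanishLT S n → ∀ f : V ⟶ S, f = 0

variable {V W : CMod k C}

theorem GenLT.mono {m n : ℕ} (h : GenLT V m) (hmn : m ≤ n) : GenLT V n :=
  fun S hS => h S (hS.mono hmn)

theorem GenLT.of_epi {n : ℕ} (h : GenLT V n) (f : V ⟶ W) [Epi f] : GenLT W n := by
  intro S hS g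
  rw [← cancel_epi f, comp_zero]
  exact h S hS _

theorem GenLT.of_isZero (h : IsZero V) (n : ℕ) : GenLT V n := fun _ _ _ => h.eq_of_src _ _

theorem GenLT.epi {n : ℕ} (h : GenLT V n) (f : W ⟶ V)
    (hf : ∀ x, rank x < n → Function.Surjective (f.app x).hom) : Epi f := by
  refine Preadditive.epi_of_cokernel_zero (h _ (fun x hx => ?_) (cokernel.π f))
  refine isZero_obj_of_epi (cokernel.π f) x fun v => ?_
  obtain ⟨w, rfl⟩ := hf x hx v
  exact (hom_eq_zero_iff _).1 (cokernel.condition f) x w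

theorem genLT_zero_iff : GenLT V 0 ↔ IsZero V :=
  ⟨fun h => (IsZero.iff_id_eq_zero V).2 (h V (fun _ hx => absurd hx (Nat.not_lt_zero _)) _),
    fun h => .of_isZero h 0⟩

/-- Strict bounds are used so that the zero module, with `gd = -1`, becomes the ordinary case `n =
0`. -/
theorem genLT_succ_iff {n : ℕ} : GenLT V (n + 1) ↔ GeneratedInDegrees V n := by
  constructor
  · intro h W i _ hi
    have := h.epi i fun x hx => hi x (Nat.lt_succ_iff.1 hx)
    exact isIso_of_mono_of_epi i
  · intro h S hS f
    have := h _ (SubMod.ker f).ι fun x hx v =>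
      ⟨⟨v, hS.eq_zero (Nat.lt_succ_iff.2 hx) _⟩, rfl⟩
    rw [← cancel_epi (SubMod.ker f).ι, comp_zero, hom_eq_zero_iff]
    exact fun x v => v.2

/-! ### Generating degree in terms of `GenLT` -/

theorem gd_of_isZero (h : IsZero V) : gd V = -1 := if_pos h

theorem gd_nonneg_of_not_isZero (h : ¬ IsZero V) : 0 ≤ gd V := by
  rw [gd, if_neg h]
  exact le_iInf₂ fun n _ => by exact_mod_cast Nat.zero_le n

theorem gd_le_natCast_iff (n : ℕ) : gd V ≤ n ↔ GenLT V (n + 1) := by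
  by_cases h : IsZero V
  · rw [gd_of_isZero h]
    refine ⟨fun _ => .of_isZero h _, fun _ => ?_⟩
    exact (by norm_num : (-1 : EReal) ≤ 0).trans (by exact_mod_cast Nat.zero_le n)
  · rw [gd, if_neg h]
    constructor
    · intro hn
      by_contra hg
      have : ((n + 1 : ℕ) : EReal) ≤ n := by
        refine le_trans (le_iInf₂ fun m hm => ?_) hn
        have : n < m := by
          by_contra hmn
          exact hg ((genLT_succ_iff.2 hm).mono (by omega))
        exact_mod_cast this
      exact absurd (by exact_mod_cast this : n + 1 ≤ n) (by omega)
    · intro hn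
      exact iInf₂_le n (genLT_succ_iff.1 hn)

theorem gd_le_sub_one_iff (n : ℕ) : gd V ≤ (n : EReal) - 1 ↔ GenLT V n := by
  cases n with
  | zero =>
    rw [genLT_zero_iff]
    constructor
    · intro h
      by_contra hz
      have := (gd_nonneg_of_not_isZero hz).trans h
      norm_num at this
      exact absurd this (not_le.2 zero_lt_one)
    · intro h
      rw [gd_of_isZero h]
      norm_num
  | succ n =>
    rw [← gd_le_natCast_iff]
    have : ((n + 1 : ℕ) : EReal) - 1 = n := by
      have h : (((n : ℝ) + 1 - 1 : ℝ) : EReal) = ((n : ℝ) : EReal) := by ring_nf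
      push_cast at h ⊢
      exact_mod_cast h
    rw [this]

theorem sub_one_le_sub_one_iff (a : EReal) (n : ℕ) : a - 1 ≤ (n : EReal) - 1 ↔ a ≤ n := by
  induction a with
  | bot => simp
  | top =>
    have h : (n : EReal) - 1 = ((n - 1 : ℝ) : EReal) := by simp
    rw [h, EReal.top_sub (by exact EReal.coe_ne_top 1), top_le_iff, top_le_iff]
    exact iff_of_false (EReal.coe_ne_top _) (EReal.natCast_ne_top n)
  | coe a =>
    have h : ((a - 1 : ℝ) : EReal) ≤ ((n - 1 : ℝ) : EReal) ↔ (a : EReal) ≤ ((n : ℝ) : EReal) := by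
      rw [EReal.coe_le_coe_iff, EReal.coe_le_coe_iff]
      exact sub_le_sub_iff_right 1
    simpa using h

/-- The set of homogeneous elements of rank `< n`. -/
def eltsLT (V : CMod k C) (n : ℕ) : Set (Σ x : C, V.obj x) := {s | rank s.1 < n}

theorem GenLT.mem_gen {n : ℕ} (h : GenLT V n) {x : C} (v : V.obj x) :
    v ∈ (SubMod.gen (eltsLT V n)).carrier x := by
  have h0 := h _ (fun x hx => ((SubMod.gen (eltsLT V n)).isZero_quot_iff x).2
    (eq_top_iff.2 fun v _ => SubMod.subset_gen (s := ⟨x, v⟩) hx)) (SubMod.gen (eltsLT V n)).π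
  exact (SubMod.π_eq_zero_iff _ v).1 ((hom_eq_zero_iff _).1 h0 x v)

/-- Each of finitely many generators is a combination of images of finitely many elements of rank `<
n`; these elements generate as well. -/
theorem IsFG.exists_eltsLT {n : ℕ} (hV : IsFG V) (h : GenLT V n) :
    ∃ S ⊆ eltsLT V n, S.Finite ∧
      ∀ (W : CMod k C) (f : V ⟶ W), (∀ s ∈ S, (f.app s.1).hom s.2 = 0) → f = 0 := by
  obtain ⟨S, hS, hSg⟩ := isFG_iff.1 hV
  have key (s : Σ x : C, V.obj x) : ∃ T ⊆ eltsLT V n, T.Finite ∧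
      s.2 ∈ (SubMod.gen T).carrier s.1 := by
    obtain ⟨T, hT, hs⟩ := Submodule.mem_span_finite_of_mem_span (h.mem_gen s.2)
    have hT' (t : T) : ∃ e ∈ eltsLT V n, ∃ g : e.1 ⟶ s.1, t.1 = (V.map g).hom e.2 := hT t.2
    choose e he g hg using hT'
    refine ⟨Set.range e, Set.range_subset_iff.2 he, Set.finite_range e, ?_⟩
    refine Submodule.span_mono (fun t ht => ?_) hs
    exact ⟨e ⟨t, ht⟩, ⟨_, rfl⟩, g ⟨t, ht⟩, hg ⟨t, ht⟩⟩
  choose T hTn hTf hT using key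
  refine ⟨⋃ s ∈ S, T s, Set.iUnion₂_subset fun s _ => hTn s, hS.biUnion fun s _ => hTf s,
    fun W f hf => hSg W f fun s hs => ?_⟩
  exact SubMod.gen_le (SubMod.ker f) (fun t ht => hf t (Set.mem_biUnion hs ht)) _ (hT s)

theorem genLT_freeMod {n : ℕ} {x : C} (hx : rank x < n) : GenLT (freeMod k x) n :=
  fun _ hS _ => freeMod_hom_ext (hS.eq_zero hx _)

theorem GenLT.of_shortExact {n : ℕ} {S : ShortComplex (CMod k C)} (hS : S.ShortExact)
    (h₁ : GenLT S.X₁ n) (h₃ : GenLT S.X₃ n) : GenLT S.X₂ n := by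
  intro U hU g
  have := hS.epi_g
  have hf := h₁ U hU (S.f ≫ g)
  rw [← hS.exact.g_desc g hf, h₃ U hU (hS.exact.desc g hf), comp_zero]

/-- Every module is a quotient of a projective module that is generated in the same ranks. -/
theorem exists_projectivePresentation (V : CMod k C) :
    ∃ p : ProjectivePresentation V, ∀ n, GenLT V n → GenLT p.p n := by
  classical
  by_cases h : ∃ n, GenLT V n
  -- Using the least bound makes one presentation serve every `n`; without any bound the condition
  -- is vacuous.
  · let L (s : eltsLT V (Nat.find h)) : CMod k C := freeMod k s.1.1
    let φ (s : eltsLT V (Nat.find h)) : L s ⟶ V := freeLift s.1.2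
    have hφ : Epi (Sigma.desc φ) := (Nat.find_spec h).epi _ fun x hx v => by
      refine ⟨((Sigma.ι L ⟨⟨x, v⟩, hx⟩).app x).hom (freeGen k x), ?_⟩
      have : Sigma.ι L ⟨⟨x, v⟩, hx⟩ ≫ Sigma.desc φ = freeLift v := Sigma.ι_desc _ _
      have h' := freeLift_freeGen v
      rw [← this] at h'
      exact h'
    have hp (s) : Projective (L s) := inferInstanceAs (Projective (freeMod k _))
    refine ⟨{ p := ∐ L, f := Sigma.desc φ }, fun n hn => GenLT.mono ?_ (Nat.find_min' h hn)⟩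
    intro S hS f
    refine Sigma.hom_ext _ _ fun s => ?_
    rw [comp_zero]
    exact genLT_freeMod s.2 S hS _
  · exact ⟨(EnoughProjectives.presentation V).some, fun n hn => absurd ⟨n, hn⟩ h⟩

/-! ### Vanishing of extensions -/

open Abelian

/-- `Ext^i(V, S) = 0` for all `i` and all `S` that vanish at the objects of rank `< c + i`. -/
def ExtVanish (V : CMod k C) (c : ℕ) : Prop :=
  ∀ (i : ℕ) (S : CMod k C), VanishLT S (c + i) → ∀ e : Ext V S i, e = 0

theorem ExtVanish.mono {c c' : ℕ} (h : ExtVanish V c) (hc : c ≤ c') : ExtVanish V c' :=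
  fun i S hS => h i S (hS.mono (by omega))

theorem GenLT.ext_zero_eq_zero {n : ℕ} (h : GenLT V n) {S : CMod k C} (hS : VanishLT S n)
    (e : Ext V S 0) : e = 0 :=
  Ext.addEquiv₀.injective (by rw [map_zero]; exact h S hS _)

theorem ExtVanish.genLT {c : ℕ} (h : ExtVanish V c) : GenLT V c := fun S hS f =>
  Ext.addEquiv₀.symm.injective (by rw [map_zero]; exact h 0 S hS _)

theorem ExtVanish.of_projective [Projective V] {c : ℕ} (h : GenLT V c) : ExtVanish V c := by
  rintro (_ | i) S hS e
  · exact h.ext_zero_eq_zero hS e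
  · exact Ext.eq_zero_of_projective e

theorem ExtVanish.of_isZero (h : IsZero V) (c : ℕ) : ExtVanish V c :=
  have := h.projective
  .of_projective (.of_isZero h c)

theorem ext_succ_eq_zero {A : Type*} [Category* A] [Abelian A] [HasExt.{u} A] {S : ShortComplex A}
    (hS : S.ShortExact) {U : A} {i : ℕ} (h₁ : ∀ e : Ext S.X₁ U i, e = 0)
    (h₂ : ∀ e : Ext S.X₂ U (i + 1), e = 0) (e : Ext S.X₃ U (i + 1)) : e = 0 := by
  obtain ⟨e', rfl⟩ := Ext.contravariant_sequence_exact₃ hS U e (h₂ _) (add_comm 1 i)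
  rw [h₁ e', Ext.comp_zero]

/-! ### Extension vanishing in short exact sequences -/

section ShortExact

variable {S : ShortComplex (CMod k C)} {c : ℕ}

theorem ExtVanish.middle (hS : S.ShortExact) (h₁ : ExtVanish S.X₁ c) (h₃ : ExtVanish S.X₃ c) :
    ExtVanish S.X₂ c := by
  intro i U hU e
  obtain ⟨e', rfl⟩ := Ext.contravariant_sequence_exact₂ hS U e (h₁ i U hU _)
  rw [h₃ i U hU e', Ext.comp_zero]

/-- `Ext^i(X₁, S)` lies between `Ext^i(X₂, S)` and `Ext^(i+1)(X₃, S)`, and `c + 1 + i = c + (i +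
1)`. This is the rule that governs syzygies. -/
theorem ExtVanish.left (hS : S.ShortExact) (h₂ : ExtVanish S.X₂ (c + 1)) (h₃ : ExtVanish S.X₃ c) :
    ExtVanish S.X₁ (c + 1) := by
  intro i U hU e
  obtain ⟨e', rfl⟩ := Ext.contravariant_sequence_exact₁ hS U e (add_comm 1 i)
    (h₃ (i + 1) U (hU.mono (by omega)) _)
  rw [h₂ i U hU e', Ext.comp_zero]

/-- In degree `0` no connecting map arrives at `X₃`; there a quotient is generated in the same
ranks. In higher degrees there is even one rank to spare on `X₁`. -/
theorem ExtVanish.right (hS : S.ShortExact) (h₁ : ExtVanish S.X₁ c) (h₂ : ExtVanish S.X₂ c) :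
    ExtVanish S.X₃ c := by
  have := hS.epi_g
  rintro (_ | i) U hU e
  · exact (h₂.genLT.of_epi S.g).ext_zero_eq_zero hU e
  · exact ext_succ_eq_zero hS (h₁ i U (hU.mono (by omega))) (h₂ (i + 1) U hU) e

end ShortExact

theorem ExtVanish.of_iso (e : V ≅ W) {c : ℕ} (h : ExtVanish V c) : ExtVanish W c := by
  have h0 := isZero_zero (CMod k C)
  have hS : (ShortComplex.mk e.hom (0 : W ⟶ 0) comp_zero).ShortExact := by
    refine shortExact_of_pointwise _ ((mono_iff_injective _).1 inferInstance)
      (fun x v => ⟨0, ?_⟩) (fun x v _ => (epi_iff_surjective e.hom).1 inferInstance x v)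
    exact (VanishLT.eq_zero (n := rank x + 1) (fun y _ => (Functor.isZero_iff _).1
      h0 y) (Nat.lt_succ_self _) v).symm
  exact ExtVanish.middle hS h (.of_isZero h0 c)

end

end GradedCategory

namespace GradedCategory

noncomputable section

/-! ### Projective resolutions by prescribed covers -/

section Resolution

variable {A : Type*} [Category* A] [Abelian A] (p : ∀ X : A, ProjectivePresentation X) (X : A)

/-- The iterated syzygies of `X` for the projective covers `p`. -/
def syz : ℕ → A
  | 0 => X
  | n + 1 => kernel (p (syz n)).f

/-- The terms of the resolution of `X` by the projective covers `p`. -/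
abbrev resTerm (n : ℕ) : A := (p (syz p X n)).p

/-- The projection of a term of the resolution to the syzygy. -/
def resπ (n : ℕ) : resTerm p X n ⟶ syz p X n := (p (syz p X n)).f

/-- The inclusion of a syzygy into a term of the resolution. -/
def resι (n : ℕ) : syz p X (n + 1) ⟶ resTerm p X n := kernel.ι (p (syz p X n)).f

instance (n : ℕ) : Epi (resπ p X n) := (p (syz p X n)).epi

instance (n : ℕ) : Mono (resι p X n) := inferInstanceAs (Mono (kernel.ι (p (syz p X n)).f))

theorem resι_resπ (n : ℕ) : resι p X n ≫ resπ p X n = 0 := kernel.condition _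

theorem shortExact_syz (n : ℕ) :
    (ShortComplex.mk (resι p X n) (resπ p X n) (resι_resπ p X n)).ShortExact :=
  have := (p (syz p X n)).epi
  shortExact_kernel (p (syz p X n)).f

/-- The differential of the resolution. -/
def resD (n : ℕ) : resTerm p X (n + 1) ⟶ resTerm p X n := resπ p X (n + 1) ≫ resι p X n

theorem resD_resπ (n : ℕ) : resD p X n ≫ resπ p X n = 0 := by
  rw [resD, Category.assoc, resι_resπ, comp_zero]

theorem resD_resD (n : ℕ) : resD p X (n + 1) ≫ resD p X n = 0 := by
  rw [resD.eq_1 p X n, ← Category.assoc, resD_resπ, zero_comp]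

theorem exact_of_shortExact_of_epi {S : ShortComplex A} (hS : S.Exact) {P : A} (q : P ⟶ S.X₁)
    [Epi q] : (ShortComplex.mk (q ≫ S.f) S.g (by simp)).Exact := by
  let α : ShortComplex.mk (q ≫ S.f) S.g (by simp) ⟶ S :=
    { τ₁ := q
      τ₂ := 𝟙 _
      τ₃ := 𝟙 _ }
  exact (ShortComplex.exact_iff_of_epi_of_isIso_of_mono α).2 hS

theorem exact_resD_resπ (n : ℕ) :
    (ShortComplex.mk (resD p X n) (resπ p X n) (resD_resπ p X n)).Exact :=
  exact_of_shortExact_of_epi (shortExact_syz p X n).exact (resπ p X (n + 1))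

theorem exact_resD_resD (n : ℕ) :
    (ShortComplex.mk (resD p X (n + 1)) (resD p X n) (resD_resD p X n)).Exact := by
  let α : ShortComplex.mk (resD p X (n + 1)) (resπ p X (n + 1)) (resD_resπ p X (n + 1)) ⟶
      ShortComplex.mk (resD p X (n + 1)) (resD p X n) (resD_resD p X n) :=
    { τ₁ := 𝟙 _
      τ₂ := 𝟙 _
      τ₃ := resι p X n }
  exact (ShortComplex.exact_iff_of_epi_of_isIso_of_mono α).1 (exact_resD_resπ p X (n + 1))

/-- The chain complex underlying the resolution. -/
def resComplex : ChainComplex A ℕ := ChainComplex.of (resTerm p X) (resD p X) (resD_resD p X)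

theorem resComplex_d (n : ℕ) : (resComplex p X).d (n + 1) n = resD p X n :=
  ChainComplex.of_d _ _ _

theorem resComplex_exactAt_succ (n : ℕ) : (resComplex p X).ExactAt (n + 1) := by
  rw [HomologicalComplex.exactAt_iff' _ (n + 1 + 1) (n + 1) n (by simp) (by simp)]
  refine (ShortComplex.exact_iff_of_iso ?_).2 (exact_resD_resD p X n)
  exact ShortComplex.isoMk (Iso.refl _) (Iso.refl _) (Iso.refl _)
    ((Category.id_comp _).trans ((resComplex_d p X _).symm.trans (Category.comp_id _).symm))
    ((Category.id_comp _).trans ((resComplex_d p X _).symm.trans (Category.comp_id _).symm))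

theorem resComplex_d_resπ : (resComplex p X).d 1 0 ≫ resπ p X 0 = 0 := by
  rw [resComplex_d]
  exact resD_resπ p X 0

/-- The resolution of `X` by the projective covers `p`. -/
def resolution : ProjectiveResolution X where
  complex := resComplex p X
  projective n := (p (syz p X n)).projective
  π := (ChainComplex.toSingle₀Equiv _ _).symm ⟨resπ p X 0, resComplex_d_resπ p X⟩
  quasiIso := ⟨fun n => by
    cases n
    · rw [ChainComplex.quasiIsoAt₀_iff, ShortComplex.quasiIso_iff_of_zeros']
      · refine (ShortComplex.exact_and_epi_g_iff_of_iso ?_).2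
          ⟨exact_resD_resπ p X 0, inferInstanceAs (Epi (resπ p X 0))⟩
        exact ShortComplex.isoMk (Iso.refl _) (Iso.refl _) (Iso.refl _)
          ((Category.id_comp _).trans ((resComplex_d p X _).symm.trans (Category.comp_id _).symm))
          ((Category.id_comp _).trans ((ChainComplex.toSingle₀Equiv_symm_apply_f_zero
            (C := resComplex p X) (X := X) (resπ p X 0) (resComplex_d_resπ p X)).symm.trans
            (Category.comp_id _).symm))
      all_goals rfl
    · rw [quasiIsoAt_iff_exactAt']
      · apply resComplex_exactAt_succ
      · apply ChainComplex.exactAt_succ_single_obj⟩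

end Resolution

end

end GradedCategory

namespace GradedCategory

noncomputable section

variable {k : Type u} [CommRing k] {C : Type u} [SmallCategory C]

variable (k) in
/-- The class of a morphism in `kC / m`. -/
def algOf {y x : C} (f : y ⟶ x) : AlgQuot k y x :=
  algMk k y x (Finsupp.single f 1)

theorem algOf_eq_zero {y x : C} (f : y ⟶ x) (h : y ≠ x) : algOf k f = 0 :=
  (Submodule.Quotient.mk_eq_zero _).2 (Submodule.subset_span ⟨⟨h, ⟨f⟩⟩, f, rfl⟩)

variable [GradedCategory C]

/-! ### The functor `kC / m ⊗_{kC} -` and generation -/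

/-- Only finitely many objects have rank at most that of `y`, so a minimal object among those above
`x` and at most `y` exists. It covers `x`, where the rank jumps by one. -/
theorem rank_lt_of_objLT {x y : C} (h : ObjLT x y) : rank x < rank y := by
  let B : Set C := {z | ObjLT x z ∧ Nonempty (z ⟶ y)}
  have hB : B.Finite := by
    refine Set.Finite.subset ((Set.finite_Iic (rank y)).biUnion fun n _ =>
      GradedCategory.locallyBounded (C := C) n) ?_
    rintro z ⟨_, hz⟩
    exact Set.mem_biUnion (rank_mono _ _ hz) rfl
  let P : PartialOrder C :=
    { le := fun a b => Nonempty (a ⟶ b)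
      le_refl := fun a => ⟨𝟙 a⟩
      le_trans := fun a b c ⟨f⟩ ⟨g⟩ => ⟨f ≫ g⟩
      le_antisymm := fun a b => directed a b }
  obtain ⟨w, hw⟩ := hB.exists_minimal ⟨y, h, ⟨𝟙 y⟩⟩
  have hc : ObjCovers x w := by
    refine ⟨hw.1.1, fun z hxz hzw => hzw.1 ?_⟩
    obtain ⟨g⟩ := hw.1.2
    obtain ⟨f⟩ := hzw.2
    exact directed _ _ ⟨f⟩ (hw.2 (y := z) ⟨hxz, ⟨f ≫ g⟩⟩ ⟨f⟩)
  have := rank_covers _ _ hc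
  have := rank_mono _ _ hw.1.2
  omega

section Tensor

variable (V : CMod k C)

open Classical in
/-- The element `q ⊗ v` of `kC / m ⊗_{kC} V`. -/
def tmulAt {y x : C} (q : AlgQuot k y x) (v : V.obj y) : TensorAt V x :=
  Submodule.Quotient.mk (DirectSum.lof k C (fun y => Summand V y x) y (q ⊗ₜ[k] v))

variable {V}

theorem tmulAt_map {y' y x : C} (f : y' ⟶ y) (q : AlgQuot k y x) (v : V.obj y') :
    tmulAt V q ((V.map f).hom v) = tmulAt V (quotRight k f x q) v := by
  classical
  refine ((Submodule.Quotient.eq _).2 ?_).symm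
  refine Submodule.subset_span ⟨y', y, f, q, v, ?_⟩
  congr!

theorem tmulAt_id_map {y x : C} (f : y ⟶ x) (v : V.obj y) :
    tmulAt V (algOf k (𝟙 x)) ((V.map f).hom v) = tmulAt V (algOf k f) v := by
  rw [tmulAt_map, algOf, quotRight_mk, Category.comp_id]
  rfl

theorem tmulAt_zero {y x : C} (v : V.obj y) : tmulAt V (0 : AlgQuot k y x) v = 0 := by
  simp [tmulAt]

/-- The map `v ↦ 1 ⊗ v`. -/
def oneTmul (V : CMod k C) (x : C) : V.obj x →ₗ[k] TensorAt V x where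
  toFun := tmulAt V (algOf k (𝟙 x))
  map_add' a b := by simp [tmulAt, TensorProduct.tmul_add]
  map_smul' a b := by simp [tmulAt, TensorProduct.tmul_smul]

theorem oneTmul_map_of_ne {y x : C} (f : y ⟶ x) (h : y ≠ x) (v : V.obj y) :
    oneTmul V x ((V.map f).hom v) = 0 :=
  (tmulAt_id_map f v).trans (by rw [algOf_eq_zero f h, tmulAt_zero])

theorem oneTmul_map {y x : C} (f : y ⟶ x) (v : V.obj y) :
    oneTmul V x ((V.map f).hom v) = tensorLeft V f (oneTmul V y v) := by
  refine (tmulAt_id_map f v).trans ?_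
  classical
  refine Eq.trans ?_ (tensorLeft_mk V f y (algOf k (𝟙 y)) v).symm
  rw [algOf, algOf, quotLeft_mk, Category.id_comp, tmulAt]

/-- Since `f ⊗ v = 1 ⊗ f v`, the elements `1 ⊗ v` span the tensor product. -/
theorem tensorAt_hom_eq_zero {x : C} {N : Type u} [AddCommGroup N] [Module k N]
    (φ : TensorAt V x →ₗ[k] N) (h : ∀ v, φ (oneTmul V x v) = 0) : φ = 0 := by
  classical
  refine tensorAt_ext fun y q v => ?_
  suffices H : φ ∘ₗ (tensorRel V x).mkQ ∘ₗ DirectSum.lof k C (fun y => Summand V y x) y ∘ₗ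
      (TensorProduct.mk k _ _).flip v = 0 from LinearMap.congr_fun H q
  refine algQuot_ext fun f => ?_
  refine Eq.trans (congrArg φ ?_) (h ((V.map f).hom v))
  refine Eq.trans ?_ (tmulAt_id_map f v).symm
  rw [tmulAt]
  congr!

theorem subsingleton_tensorAt {x : C} (h : ∀ v, oneTmul V x v = 0) :
    Subsingleton (TensorAt V x) := by
  have : (LinearMap.id : TensorAt V x →ₗ[k] TensorAt V x) = 0 := tensorAt_hom_eq_zero _ h
  exact subsingleton_of_forall_eq 0 fun t => LinearMap.congr_fun this t

/-- A linear map on `V_x` that kills the images of all morphisms `y ⟶ x`, `y ≠ x`, factors through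
`kC / m ⊗_{kC} V`. -/
theorem exists_tensorAt_lift {x : C} {N : Type u} [AddCommGroup N] [Module k N]
    (φ : V.obj x →ₗ[k] N)
    (hφ : ∀ (y : C) (f : y ⟶ x), y ≠ x → ∀ v, φ ((V.map f).hom v) = 0) :
    ∃ ψ : TensorAt V x →ₗ[k] N, ∀ v, ψ (oneTmul V x v) = φ v := by
  classical
  let a (y : C) : AlgQuot k y x →ₗ[k] (V.obj y →ₗ[k] N) :=
    (ideal k y x).liftQ (Finsupp.lift _ k _ fun f : y ⟶ x => φ ∘ₗ (V.map f).hom) (by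
      refine Submodule.span_le.2 ?_
      rintro _ ⟨h, f, rfl⟩
      refine LinearMap.ext fun v => ?_
      simpa using hφ y f h.1 v)
  have ha (y : C) (f : y ⟶ x) (v : V.obj y) : a y (algOf k f) v = φ ((V.map f).hom v) := by
    change Finsupp.lift _ k _ (fun f : y ⟶ x => φ ∘ₗ (V.map f).hom) (Finsupp.single f 1) v = _
    simp
  have hr (y' y : C) (f : y' ⟶ y) (v : V.obj y') (q : AlgQuot k y x) :
      a y' (quotRight k f x q) v = a y q ((V.map f).hom v) := by
    suffices H : (a y' ∘ₗ quotRight k f x).flip v = (a y).flip ((V.map f).hom v) from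
      LinearMap.congr_fun H q
    refine algQuot_ext fun g => ?_
    change a y' (quotRight k f x (algMk k y x (Finsupp.single g 1))) v =
      a y (algOf k g) ((V.map f).hom v)
    rw [quotRight_mk]
    refine (ha y' (f ≫ g) v).trans ?_
    rw [ha]
    simp
  refine ⟨(tensorRel V x).liftQ (DirectSum.toModule k C N fun y => TensorProduct.lift (a y)) ?_,
    fun v => ?_⟩
  · refine Submodule.span_le.2 ?_
    rintro _ ⟨y', y, f, q, v, rfl⟩
    change DirectSum.toModule k C N _ _ = 0
    erw [map_sub, DirectSum.toModule_lof, DirectSum.toModule_lof]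
    simp [hr]
  · refine (Submodule.liftQ_apply _ _ _).trans ?_
    erw [DirectSum.toModule_lof]
    simp [ha]

/-- Nakayama's lemma, by induction on the rank: once a morphism is zero in smaller ranks, its
component at `x` factors through the tensor product at `x`, which is zero. -/
theorem genLT_of_tensor {n : ℕ} (h : ∀ x, n ≤ rank x → Subsingleton (TensorAt V x)) :
    GenLT V n := by
  intro S hS f
  rw [hom_eq_zero_iff]
  suffices H : ∀ m x, rank x = m → ∀ v : V.obj x, (f.app x).hom v = 0 from
    fun x v => H _ x rfl v
  intro m
  induction m using Nat.strong_induction_on with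
  | _ m ih =>
    rintro x rfl v
    rcases lt_or_ge (rank x) n with hx | hx
    · exact hS.eq_zero hx _
    · obtain ⟨ψ, hψ⟩ := exists_tensorAt_lift (f.app x).hom fun y g hy w => by
        rw [map_app_hom, ih _ (rank_lt_of_objLT ⟨hy, ⟨g⟩⟩) y rfl w, map_zero]
      rw [← hψ, (h x hx).elim (oneTmul V x v) 0, map_zero]

/-- The elements `v` with `1 ⊗ v = 0`, together with everything in ranks `< n`, form a submodule
because morphisms between distinct objects act as zero on `kC / m`. It contains the generating
ranks, so it is all of `V`. -/
theorem GenLT.subsingleton_tensorAt {n : ℕ} (h : GenLT V n) {x : C} (hx : n ≤ rank x) :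
    Subsingleton (TensorAt V x) := by
  let N : SubMod V :=
    { carrier := fun y =>
        { carrier := {v | n ≤ rank y → oneTmul V y v = 0}
          add_mem' := fun ha hb hy => by rw [map_add, ha hy, hb hy, add_zero]
          zero_mem' := fun _ => map_zero _
          smul_mem' := fun c _ ha hy => by rw [map_smul, ha hy, smul_zero] }
      map_mem := fun {y z} g v hv hz => by
        rcases le_or_gt n (rank y) with hy | hy
        · rw [oneTmul_map, hv hy, map_zero]
        · refine oneTmul_map_of_ne g ?_ v
          rintro rfl
          omega }
  have h0 : N.π = 0 := h _ (fun y hy => (N.isZero_quot_iff y).2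
    (eq_top_iff.2 fun v _ hy' => absurd hy' (by omega))) _
  exact GradedCategory.subsingleton_tensorAt fun v =>
    (N.π_eq_zero_iff v).1 ((hom_eq_zero_iff _).1 h0 x v) hx

theorem tensorMap_surjective {W : CMod k C} (η : V ⟶ W) [Epi η] (x : C) :
    Function.Surjective (tensorMap η x) := by
  rw [← LinearMap.range_eq_top, ← Submodule.ker_mkQ (LinearMap.range (tensorMap η x)),
    LinearMap.ker_eq_top]
  refine tensorAt_hom_eq_zero _ fun w => ?_
  obtain ⟨v, rfl⟩ := (epi_iff_surjective η).1 inferInstance x w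
  refine (Submodule.Quotient.mk_eq_zero _).2 ⟨oneTmul V x v, ?_⟩
  classical
  exact (tensorMap_mk η x (algOf k (𝟙 x)) v).trans (by congr!)

end Tensor

end

end GradedCategory

namespace GradedCategory

noncomputable section

variable {k : Type u} [CommRing k] {C : Type u} [SmallCategory C]

/-! ### Regularity and vanishing of extensions -/

theorem isZero_homology_obj (K : ChainComplex (CMod k C) ℕ) (i : ℕ) (y : C)
    (h : IsZero ((K.X i).obj y)) : IsZero ((K.homology i).obj y) := by
  have h₁ : IsZero ((K.cycles i).obj y) :=
    IsZero.of_mono (((evaluation C (ModuleCat.{u} k)).obj y).map (K.iCycles i)) h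
  exact IsZero.of_epi (((evaluation C (ModuleCat.{u} k)).obj y).map (K.homologyπ i)) h₁

/-- At `y` every chain of degree `i` is a cycle, hence a boundary, and `q` kills boundaries. -/
theorem app_eq_zero_of_isZero_homology (K : ChainComplex (CMod k C) ℕ) (i : ℕ) (y : C)
    (h : IsZero ((K.homology i).obj y)) (hd : ∀ j, (K.d i j).app y = 0) {Z : CMod k C}
    (q : K.X i ⟶ Z) (hq : ∀ j, K.d j i ≫ q = 0) : q.app y = 0 := by
  have hex : ((K.sc i).map ((evaluation C (ModuleCat.{u} k)).obj y)).Exact := by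
    rw [ShortComplex.exact_iff_isZero_homology]
    exact IsZero.of_iso h ((K.sc i).mapHomologyIso ((evaluation C (ModuleCat.{u} k)).obj y))
  rw [ShortComplex.moduleCat_exact_iff] at hex
  ext v
  obtain ⟨w, rfl⟩ := hex v (by
    change ((K.d i _).app y).hom v = 0
    rw [hd]
    rfl)
  exact (hom_eq_zero_iff _).1 (hq _) y w

variable [GradedCategory C]

/-- A projective presentation of `V` generated in the same ranks as `V`. -/
def cover (V : CMod k C) : ProjectivePresentation V := (exists_projectivePresentation V).choose

theorem GenLT.cover {V : CMod k C} {n : ℕ} (h : GenLT V n) : GenLT (cover V).p n :=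
  (exists_projectivePresentation V).choose_spec n h

variable (V : CMod k C)

/-- The complex `kC / m ⊗_{kC} P` for the resolution `P` of `V` by covers. -/
abbrev tensorRes : ChainComplex (CMod k C) ℕ :=
  ((tensorFunctor k C).mapHomologicalComplex _).obj (resolution cover V).complex

/-- The homology of `V` is computed by the resolution by covers. -/
def homologyIso (i : ℕ) : homology i V ≅ (tensorRes V).homology i :=
  (resolution cover V).isoLeftDerivedObj (tensorFunctor k C) i

variable {V}

theorem isZero_tensorFunctor_obj {n : ℕ} (h : GenLT V n) {y : C} (hy : n ≤ rank y) :
    IsZero (((tensorFunctor k C).obj V).obj y) :=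
  ModuleCat.isZero_iff_subsingleton.2 (h.subsingleton_tensorAt hy)

/-- The bound grows by one with each syzygy, so the `i`-th term of the resolution is generated in
ranks `< c + i` and dies after tensoring in all other ranks. -/
theorem ExtVanish.isZero_homology {c : ℕ} (h : ExtVanish V c) (i : ℕ) {y : C}
    (hy : c + i ≤ rank y) : IsZero ((homology i V).obj y) := by
  have hZ (j : ℕ) : ExtVanish (syz cover V j) (c + j) := by
    induction j with
    | zero => exact h
    | succ j ih =>
      have := (cover (syz cover V j)).projective
      exact ExtVanish.left (shortExact_syz cover V j)
        ((ExtVanish.of_projective ih.genLT.cover).mono (Nat.le_succ _)) ih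
  refine IsZero.of_iso (isZero_homology_obj (tensorRes V) i y ?_) ((homologyIso V i).app y)
  exact isZero_tensorFunctor_obj (V := resTerm cover V i) (hZ i).genLT.cover hy

/-- The hypothesis `hj` makes the outgoing differential zero at `y`. This replaces minimality of the
resolution: the covers need only be generated in the right ranks. -/
theorem subsingleton_tensorAt_syz {j : ℕ} {y : C} (h : IsZero ((homology j V).obj y))
    (hj : ∀ i, i + 1 = j → IsZero (((tensorFunctor k C).obj (resTerm cover V i)).obj y)) :
    Subsingleton (TensorAt (syz cover V j) y) := by
  have h₀ : ((tensorFunctor k C).map (resπ cover V j)).app y = 0 := by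
    refine app_eq_zero_of_isZero_homology (tensorRes V) j y
      (IsZero.of_iso h ((homologyIso V j).symm.app y)) (fun i => ?_) _ (fun i => ?_)
    · by_cases hi : i + 1 = j
      · exact (hj i hi).eq_of_tgt _ _
      · rw [(tensorRes V).shape j i hi]
        rfl
    · by_cases hi : j + 1 = i
      · subst hi
        have hd : (tensorFunctor k C).map (resD cover V j) ≫
            (tensorFunctor k C).map (resπ cover V j) = 0 := by
          rw [← Functor.map_comp, resD_resπ, Functor.map_zero]
        rw [← resComplex_d] at hd
        exact hd
      · rw [(tensorRes V).shape i j hi]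
        exact zero_comp
  refine subsingleton_of_forall_eq 0 fun t => ?_
  obtain ⟨s, rfl⟩ := tensorMap_surjective (resπ cover V j) y t
  exact LinearMap.congr_fun (congrArg ModuleCat.Hom.hom h₀) s

theorem extVanish_of_isZero_homology {c : ℕ}
    (h : ∀ i y, c + i ≤ rank y → IsZero ((homology i V).obj y)) : ExtVanish V c := by
  have hZ (j : ℕ) : GenLT (syz cover V j) (c + j) := by
    induction j with
    | zero =>
      exact genLT_of_tensor fun y hy => subsingleton_tensorAt_syz (h 0 y hy)
        fun i hi => absurd hi (by omega)
    | succ j ih =>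
      refine genLT_of_tensor fun y hy => subsingleton_tensorAt_syz (h (j + 1) y hy) fun i hi => ?_
      obtain rfl : i = j := by omega
      exact isZero_tensorFunctor_obj (V := resTerm cover V i) ih.cover (by omega)
  -- Dimension shifting moves from one syzygy to the next, so all of them are treated together.
  suffices H : ∀ (i j : ℕ) (S : CMod k C), VanishLT S (c + j + i) →
      ∀ e : Abelian.Ext (syz cover V j) S i, e = 0 from fun i S hS => H i 0 S hS
  intro i
  induction i with
  | zero => exact fun j S hS => (hZ j).ext_zero_eq_zero hS
  | succ i ih =>
    intro j S hS
    have := (cover (syz cover V j)).projective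
    exact ext_succ_eq_zero (shortExact_syz cover V j) (ih (j + 1) S (hS.mono (by omega)))
      Abelian.Ext.eq_zero_of_projective

theorem ExtVanish.reg_lt_top {c : ℕ} (h : ExtVanish V c) : reg V < ⊤ := by
  refine lt_of_le_of_lt (iSup_le fun i => ?_) (lt_top_iff_ne_top.2 (EReal.natCast_ne_top c))
  refine EReal.sub_le_of_le_add ?_
  have hci : ((c + i : ℕ) : EReal) = c + i := by norm_cast
  rw [← hci, hd]
  split_ifs with hz
  -- The default value `-1` for vanishing homology also respects the bound `c + i`.
  · exact (by norm_num : (-1 : EReal) ≤ 0).trans (by exact_mod_cast Nat.zero_le _)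
  · refine iSup₂_le fun x hx => EReal.natCast_le_iff.2 ?_
    by_contra hlt
    exact hx (h.isZero_homology i (by omega))

/-- The `+ 1` turns the bound `≤ c + i` on the support of `H_i` into a strict one. -/
theorem extVanish_of_reg_le {c : ℕ} (h : reg V ≤ c) : ExtVanish V (c + 1) := by
  refine extVanish_of_isZero_homology fun i y hy => ?_
  by_contra hz
  have h₁ : hd i V - i ≤ c := (le_iSup (fun i : ℕ => hd i V - (i : EReal)) i).trans h
  have h₂ : (rank y : EReal) ≤ hd i V := by
    rw [hd, if_neg fun h0 => hz ((Functor.isZero_iff _).1 h0 y)]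
    exact le_iSup₂ (f := fun (x : C) (_ : ¬ IsZero ((homology i V).obj x)) => (rank x : EReal)) y hz
  rw [EReal.sub_le_iff_le_add (Or.inl (EReal.natCast_ne_bot i))
    (Or.inl (EReal.natCast_ne_top i))] at h₁
  have h₃ : rank y ≤ c + i := EReal.natCast_le_iff.1 ((h₂.trans h₁).trans (by norm_cast))
  omega

end

end GradedCategory

namespace GradedCategory

noncomputable section

variable {k : Type u} [CommRing k] {C : Type u} [SmallCategory C]

/-! ### Finite direct sums of free modules -/

theorem shortExact_biprod (V W : CMod k C) :
    (ShortComplex.mk (biprod.inl : V ⟶ V ⊞ W) (biprod.snd : V ⊞ W ⟶ W) (by simp)).ShortExact :=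
  (ShortComplex.Splitting.ofHasBinaryBiproduct V W).shortExact

variable [GradedCategory C]

/-- Finite direct sums of modules `M(x)` with `|x| < n`. -/
inductive IsFinFree (n : ℕ) : CMod k C → Prop
  | zero : IsFinFree n 0
  | add {P : CMod k C} (x : C) : rank x < n → IsFinFree n P → IsFinFree n (P ⊞ freeMod k x)

namespace IsFinFree

variable {n : ℕ} {P : CMod k C}

theorem projective (h : IsFinFree n P) : Projective P := by
  induction h with
  | zero => exact (isZero_zero _).projective
  | add x _ _ ih => infer_instance

theorem isFG (h : IsFinFree n P) : IsFG P := by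
  induction h with
  | zero => exact .of_isZero (isZero_zero _)
  | add x _ _ ih => exact .of_shortExact (shortExact_biprod _ _) ih (isFG_freeMod x)

theorem genLT (h : IsFinFree n P) : GenLT P n := by
  induction h with
  | zero => exact .of_isZero (isZero_zero _) n
  | add x hx _ ih => exact .of_shortExact (shortExact_biprod _ _) ih (genLT_freeMod hx)

theorem extVanish (h : IsFinFree n P) : ExtVanish P n :=
  have := h.projective
  .of_projective h.genLT

end IsFinFree

/-- A finitely generated module that is generated in ranks `< n` is a quotient of a finite direct
sum of free modules `M(x)` with `|x| < n`. -/
theorem IsFG.exists_isFinFree {V : CMod k C} {n : ℕ} (hV : IsFG V) (h : GenLT V n) :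
    ∃ (P : CMod k C) (f : P ⟶ V), IsFinFree n P ∧ Epi f := by
  obtain ⟨S, hSn, hS, hg⟩ := hV.exists_eltsLT h
  suffices H : ∃ (P : CMod k C) (f : P ⟶ V), IsFinFree n P ∧
      ∀ s ∈ S, ∃ p, (f.app s.1).hom p = s.2 by
    obtain ⟨P, f, hP, hf⟩ := H
    refine ⟨P, f, hP, Preadditive.epi_of_cokernel_zero (hg _ (cokernel.π f) fun s hs => ?_)⟩
    obtain ⟨p, hp⟩ := hf s hs
    rw [← hp]
    exact (hom_eq_zero_iff _).1 (cokernel.condition f) _ p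
  clear hg
  induction S, hS using Set.Finite.induction_on with
  | empty => exact ⟨0, 0, .zero, fun s hs => hs.elim⟩
  | @insert s S _ _ ih =>
    obtain ⟨P, f, hP, hf⟩ := ih ((Set.subset_insert _ _).trans hSn)
    refine ⟨P ⊞ freeMod k s.1, biprod.desc f (freeLift s.2),
      .add _ (hSn (Set.mem_insert _ _)) hP, ?_⟩
    rintro t (rfl | ht)
    · refine ⟨((biprod.inr : _ ⟶ P ⊞ freeMod k t.1).app t.1).hom (freeGen k t.1), ?_⟩
      have h := freeLift_freeGen t.2
      rw [← biprod.inr_desc f (freeLift t.2)] at h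
      exact h
    · obtain ⟨p, hp⟩ := hf t ht
      refine ⟨((biprod.inl : _ ⟶ P ⊞ freeMod k s.1).app t.1).hom p, ?_⟩
      rw [← biprod.inl_desc f (freeLift s.2)] at hp
      exact hp

/-! ### The components of an inductive functor -/

variable {d : ℕ} (I : InductiveFunctor k C d)

namespace InductiveFunctor

instance : PreservesFiniteLimits I.F := I.preservesFiniteLimits

instance : PreservesFiniteColimits I.F := I.preservesFiniteColimits

instance : I.F.PreservesZeroMorphisms := inferInstance

/-- The morphism `θ_V`. -/
def theta (V : CMod k C) : (⨁ fun _ : Fin d => V) ⟶ I.F.obj V := I.θ.app V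

theorem theta_naturality {V W : CMod k C} (f : V ⟶ W) :
    I.theta V ≫ I.F.map f = biproduct.map (fun _ : Fin d => f) ≫ I.theta W :=
  (I.θ.naturality f).symm

/-- The `j`-th component `Id ⟶ F` of `θ`. -/
def comp (j : Fin d) (V : CMod k C) : V ⟶ I.F.obj V :=
  biproduct.ι (fun _ : Fin d => V) j ≫ I.theta V

theorem comp_naturality (j : Fin d) {V W : CMod k C} (f : V ⟶ W) :
    I.comp j V ≫ I.F.map f = f ≫ I.comp j W := by
  rw [comp, Category.assoc, theta_naturality, biproduct.ι_map_assoc, comp]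

theorem comp_map_apply (j : Fin d) {V W : CMod k C} (f : V ⟶ W) {x : C} (v : V.obj x) :
    ((I.F.map f).app x).hom (((I.comp j V).app x).hom v) =
      ((I.comp j W).app x).hom ((f.app x).hom v) :=
  LinearMap.congr_fun (congrArg ModuleCat.Hom.hom (congrArg (fun η => NatTrans.app η x)
    (I.comp_naturality j f))) v

/-- The map `(v_j)_j ↦ ∑_{j ∈ J} θ_j v_j`. -/
def sumMap (J : Finset (Fin d)) (V : CMod k C) (x : C) :
    (Fin d → V.obj x) →ₗ[k] (I.F.obj V).obj x :=
  ∑ j ∈ J, ((I.comp j V).app x).hom ∘ₗ LinearMap.proj j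

theorem sumMap_apply (J : Finset (Fin d)) (V : CMod k C) (x : C) (v : Fin d → V.obj x) :
    I.sumMap J V x v = ∑ j ∈ J, ((I.comp j V).app x).hom (v j) := by
  simp [sumMap]

theorem map_sumMap (J : Finset (Fin d)) {V W : CMod k C} (f : V ⟶ W) (x : C)
    (v : Fin d → V.obj x) :
    ((I.F.map f).app x).hom (I.sumMap J V x v) = I.sumMap J W x fun j => (f.app x).hom (v j) := by
  rw [sumMap_apply, sumMap_apply, map_sum]
  exact Finset.sum_congr rfl fun j _ => I.comp_map_apply j f (v j)

/-- The components `θ_j`, `j ∈ J`, embed `V^J` into `FV`. -/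
def Good (J : Finset (Fin d)) (V : CMod k C) : Prop :=
  ∀ (x : C) (v : Fin d → V.obj x), I.sumMap J V x v = 0 → ∀ j ∈ J, v j = 0

/-- The submodule `∑_{j ∈ J} θ_j V` of `FV`. -/
def rangeSub (J : Finset (Fin d)) (V : CMod k C) : SubMod (I.F.obj V) where
  carrier x := LinearMap.range (I.sumMap J V x)
  map_mem {x y} g := by
    rintro _ ⟨v, rfl⟩
    refine ⟨fun j => (V.map g).hom (v j), ?_⟩
    rw [sumMap_apply, sumMap_apply, map_sum]
    exact Finset.sum_congr rfl fun j _ => map_app_hom (I.comp j V) g (v j)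

/-- The quotient of `FV` by `∑_{j ∈ J} θ_j V`. -/
def coker (J : Finset (Fin d)) (V : CMod k C) : CMod k C := (I.rangeSub J V).quot

/-- The projection of `FV` to its quotient by `∑_{j ∈ J} θ_j V`. -/
def proj (J : Finset (Fin d)) (V : CMod k C) : I.F.obj V ⟶ I.coker J V := (I.rangeSub J V).π

instance (J : Finset (Fin d)) (V : CMod k C) : Epi (I.proj J V) :=
  inferInstanceAs (Epi (I.rangeSub J V).π)

variable {I} {J : Finset (Fin d)} {V W : CMod k C}

theorem proj_surjective (x : C) : Function.Surjective ((I.proj J V).app x).hom :=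
  (I.rangeSub J V).π_surjective x

theorem proj_eq_zero_iff {x : C} (w : (I.F.obj V).obj x) :
    ((I.proj J V).app x).hom w = 0 ↔ ∃ v, I.sumMap J V x v = w :=
  (I.rangeSub J V).π_eq_zero_iff w

variable (I J) in
/-- The functoriality of the quotient `coker`. -/
def cokerMap (f : V ⟶ W) : I.coker J V ⟶ I.coker J W :=
  (I.rangeSub J V).desc (I.F.map f ≫ I.proj J W) (by
    rintro x _ ⟨v, rfl⟩
    rw [NatTrans.comp_app, ModuleCat.hom_comp, LinearMap.comp_apply, map_sumMap, proj_eq_zero_iff]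
    exact ⟨_, rfl⟩)

theorem cokerMap_proj (f : V ⟶ W) {x : C} (w : (I.F.obj V).obj x) :
    ((I.cokerMap J f).app x).hom (((I.proj J V).app x).hom w) =
      ((I.proj J W).app x).hom (((I.F.map f).app x).hom w) := rfl

section Exact

variable {S : ShortComplex (CMod k C)}

theorem map_zero_apply (S : ShortComplex (CMod k C)) (x : C) (w : (I.F.obj S.X₁).obj x) :
    ((I.F.map S.g).app x).hom (((I.F.map S.f).app x).hom w) = 0 :=
  ShortExact.zero_apply (S.map I.F) x w

theorem map_injective (hS : S.ShortExact) (x : C) : Function.Injective ((I.F.map S.f).app x).hom :=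
  ShortExact.injective (hS.map_of_exact I.F) x

theorem map_surjective (hS : S.ShortExact) (x : C) : Function.Surjective ((I.F.map S.g).app x).hom :=
  ShortExact.surjective (hS.map_of_exact I.F) x

theorem map_exists_of_eq_zero (hS : S.ShortExact) (x : C) (w : (I.F.obj S.X₂).obj x)
    (hw : ((I.F.map S.g).app x).hom w = 0) :
    ∃ u, ((I.F.map S.f).app x).hom u = w :=
  ShortExact.exists_of_eq_zero (hS.map_of_exact I.F) x w hw

/-- A family in `X₂` that is killed by `g` in the places of `J` comes from `X₁` in these places. -/
theorem exists_lift (hS : S.ShortExact) (x : C) (v : Fin d → S.X₂.obj x)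
    (hv : ∀ j ∈ J, (S.g.app x).hom (v j) = 0) :
    ∃ w : Fin d → S.X₁.obj x,
      I.sumMap J S.X₂ x (fun j => (S.f.app x).hom (w j)) = I.sumMap J S.X₂ x v ∧
      ∀ j ∈ J, (S.f.app x).hom (w j) = v j := by
  have hl (j : Fin d) : ∃ w, j ∈ J → (S.f.app x).hom w = v j := by
    by_cases hj : j ∈ J
    · obtain ⟨w, hw⟩ := ShortExact.exists_of_eq_zero hS x (v j) (hv j hj)
      exact ⟨w, fun _ => hw⟩
    · exact ⟨0, fun h => absurd h hj⟩
  choose w hw using hl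
  refine ⟨w, ?_, hw⟩
  rw [sumMap_apply, sumMap_apply]
  exact Finset.sum_congr rfl fun j hj => by rw [hw j hj]

end Exact

/-! ### Stability of the embedding property -/

theorem Good.of_mono (h : I.Good J W) (f : V ⟶ W) [Mono f] : I.Good J V := by
  intro x v hv j hj
  refine (mono_iff_injective f).1 inferInstance x ?_
  rw [map_zero]
  refine h x (fun j => (f.app x).hom (v j)) ?_ j hj
  rw [← map_sumMap, hv, map_zero]

/-- A relation in `F X₂` maps to one in `F X₃`, so its coefficients in `J` come from `X₁`;
injectivity of `F X₁ ⟶ F X₂` makes it a relation there. -/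
theorem Good.of_shortExact {S : ShortComplex (CMod k C)} (hS : S.ShortExact)
    (h₁ : I.Good J S.X₁) (h₃ : I.Good J S.X₃) : I.Good J S.X₂ := by
  intro x v hv
  have hg := h₃ x (fun j => (S.g.app x).hom (v j)) (by rw [← map_sumMap, hv, map_zero])
  obtain ⟨w, hwv, hw⟩ := exists_lift (I := I) hS x v hg
  have hw0 : I.sumMap J S.X₁ x w = 0 := by
    refine map_injective hS x ?_
    rw [map_sumMap, hwv, hv, map_zero]
  intro j hj
  rw [← hw j hj, h₁ x w hw0 j hj, map_zero]

theorem Good.of_isZero (h : IsZero V) : I.Good J V := fun x _ _ _ _ =>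
  (ModuleCat.isZero_iff_subsingleton.1 ((Functor.isZero_iff _).1 h x)).elim _ _

theorem Good.subset {J' : Finset (Fin d)} (h : I.Good J' V) (hJ : J ⊆ J') : I.Good J V := by
  classical
  intro x v hv j hj
  have := h x (fun i => if i ∈ J then v i else 0) (by
    rw [sumMap_apply] at hv ⊢
    rw [← hv, ← Finset.sum_subset hJ]
    · exact Finset.sum_congr rfl fun i hi => by rw [if_pos hi]
    · intro i _ hi
      rw [if_neg hi, map_zero]) j (hJ hj)
  simpa [hj] using this

/-- For the full index set this is the injectivity of `θ_{M(x)}`, read through the inclusions and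
projections of the biproduct. -/
theorem good_freeMod (x : C) : I.Good J (freeMod k x) := by
  refine Good.subset (J' := Finset.univ) ?_ (Finset.subset_univ J)
  intro y v hv j _
  have hinj := (mono_iff_injective (I.theta _)).1 (I.mono_free x) y
  let P := freeMod k x
  let s : (⨁ fun _ : Fin d => P).obj y :=
    ∑ i, ((biproduct.ι (fun _ : Fin d => P) i).app y).hom (v i)
  have hs : s = 0 := by
    refine hinj ?_
    rw [map_zero, ← hv, sumMap_apply]
    exact map_sum _ _ _
  have hπ (i : Fin d) : ((biproduct.π (fun _ : Fin d => P) j).app y).hom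
      (((biproduct.ι (fun _ : Fin d => P) i).app y).hom (v i)) = if i = j then v j else 0 := by
    have h := biproduct.ι_π (fun _ : Fin d => P) i j
    have h' := LinearMap.congr_fun (congrArg ModuleCat.Hom.hom (congrArg (fun η => NatTrans.app η y)
      h)) (v i)
    refine h'.trans ?_
    split_ifs with hij
    · subst hij; rfl
    · rfl
  have := congrArg ((biproduct.π (fun _ : Fin d => P) j).app y).hom hs
  rw [map_zero, map_sum] at this
  simpa [hπ] using this

/-! ### Exactness of the quotients `coker` -/

theorem cokerMap_comp_eq_zero (S : ShortComplex (CMod k C)) :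
    I.cokerMap J S.f ≫ I.cokerMap J S.g = 0 := by
  rw [hom_eq_zero_iff]
  intro x w
  obtain ⟨w, rfl⟩ := proj_surjective x w
  rw [NatTrans.comp_app, ModuleCat.hom_comp, LinearMap.comp_apply, cokerMap_proj, cokerMap_proj,
    map_zero_apply, map_zero]

/-- The snake lemma for `X^J ⟶ FX`: its kernel at `X₃` is the only obstruction to injectivity on the
left, and it vanishes by `h₃`. -/
theorem shortExact_coker {S : ShortComplex (CMod k C)} (hS : S.ShortExact)
    (h₃ : I.Good J S.X₃) :
    (ShortComplex.mk (I.cokerMap J S.f) (I.cokerMap J S.g) (cokerMap_comp_eq_zero S)).ShortExact := by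
  refine shortExact_of_pointwise _ (fun x => ?_) (fun x w => ?_) (fun x w hw => ?_)
  · refine (injective_iff_map_eq_zero (((I.cokerMap J S.f).app x).hom)).2 fun w hw => ?_
    obtain ⟨w, rfl⟩ := proj_surjective x w
    rw [cokerMap_proj, proj_eq_zero_iff] at hw
    obtain ⟨v, hv⟩ := hw
    have hg := h₃ x (fun j => (S.g.app x).hom (v j)) (by rw [← map_sumMap, hv, map_zero_apply])
    obtain ⟨u, huv, -⟩ := exists_lift (I := I) hS x v hg
    refine (proj_eq_zero_iff _).2 ⟨u, map_injective hS x ?_⟩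
    rw [map_sumMap, huv, hv]
  · obtain ⟨w, rfl⟩ := proj_surjective x w
    obtain ⟨u, rfl⟩ := map_surjective hS x w
    exact ⟨((I.proj J S.X₂).app x).hom u, rfl⟩
  · obtain ⟨w, rfl⟩ := proj_surjective x w
    obtain ⟨v, hv⟩ := (proj_eq_zero_iff _).1 hw
    choose l hl using ShortExact.surjective hS x
    obtain ⟨u, hu⟩ := map_exists_of_eq_zero hS x
      (w - I.sumMap J S.X₂ x fun j => l (v j)) (by
        rw [map_sub, sub_eq_zero, map_sumMap]
        simp only [hl]
        exact hv.symm)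
    refine ⟨((I.proj J S.X₁).app x).hom u, ?_⟩
    refine (cokerMap_proj _ _).trans ?_
    rw [hu, map_sub, (proj_eq_zero_iff (I.sumMap J S.X₂ x fun j => l (v j))).2 ⟨_, rfl⟩, sub_zero]

end InductiveFunctor

end

end GradedCategory

namespace GradedCategory

noncomputable section

variable {k : Type u} [CommRing k] {C : Type u} [SmallCategory C] [GradedCategory C]
variable {d : ℕ}

namespace InductiveFunctor

/-! ### Adding components one at a time -/

variable {I : InductiveFunctor k C d} {J J' : Finset (Fin d)} {V W : CMod k C}

theorem rangeSub_mono (hJ : J ⊆ J') : I.rangeSub J V ≤ I.rangeSub J' V := by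
  classical
  rintro x _ ⟨v, rfl⟩
  refine ⟨fun i => if i ∈ J then v i else 0, ?_⟩
  rw [sumMap_apply, sumMap_apply, ← Finset.sum_subset hJ]
  · exact Finset.sum_congr rfl fun i hi => by rw [if_pos hi]
  · intro i _ hi
    rw [if_neg hi, map_zero]

variable (I V) in
/-- The projection between the quotients of `FV` for `J ⊆ J'`. -/
def cokerProj (hJ : J ⊆ J') : I.coker J V ⟶ I.coker J' V :=
  (I.rangeSub J V).desc (I.proj J' V) fun x w hw =>
    ((I.rangeSub J' V).π_eq_zero_iff w).2 (rangeSub_mono hJ x hw)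

variable (I V) in
/-- The morphism `V ⟶ FV ⟶ FV / ∑_{j ∈ J} θ_j V` induced by `θ_i`. -/
def compProj (i : Fin d) (J : Finset (Fin d)) : V ⟶ I.coker J V := I.comp i V ≫ I.proj J V

theorem compProj_apply (i : Fin d) {x : C} (v : V.obj x) :
    ((I.compProj V i J).app x).hom v =
      ((I.proj J V).app x).hom (((I.comp i V).app x).hom v) := rfl

theorem compProj_cokerProj (i : Fin d) (hJ : J ⊆ J') :
    I.compProj V i J ≫ I.cokerProj V hJ = I.compProj V i J' := rfl

variable [DecidableEq (Fin d)]

theorem sumMap_insert {i : Fin d} (hi : i ∉ J) {x : C} (v : Fin d → V.obj x) :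
    I.sumMap (insert i J) V x v = ((I.comp i V).app x).hom (v i) + I.sumMap J V x v := by
  rw [sumMap_apply, sumMap_apply, Finset.sum_insert hi]

theorem sumMap_update {i : Fin d} (hi : i ∉ J) {x : C} (v : Fin d → V.obj x) (a : V.obj x) :
    I.sumMap J V x (Function.update v i a) = I.sumMap J V x v := by
  rw [sumMap_apply, sumMap_apply]
  refine Finset.sum_congr rfl fun j hj => ?_
  rw [Function.update_of_ne]
  rintro rfl
  exact hi hj

theorem Good.mono_compProj {i : Fin d} (hi : i ∉ J) (h : I.Good (insert i J) V) :
    Mono (I.compProj V i J) := by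
  refine (mono_iff_injective _).2 fun x =>
    (injective_iff_map_eq_zero ((I.compProj V i J).app x).hom).2 fun v hv => ?_
  rw [compProj_apply, proj_eq_zero_iff] at hv
  obtain ⟨u, hu⟩ := hv
  -- If `θ_i v = ∑ θ_j u_j`, the family with entry `v` at `i` and `-u_j` elsewhere is a relation.
  have := h x (Function.update (-u) i v) (by
    rw [sumMap_insert hi, sumMap_update hi, Function.update_self, map_neg, hu, add_neg_cancel])
    i (Finset.mem_insert_self i J)
  rwa [Function.update_self] at this

theorem Good.insert {i : Fin d} (hi : i ∉ J) (h : I.Good J V) [Mono (I.compProj V i J)] :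
    I.Good (insert i J) V := by
  intro x v hv
  rw [sumMap_insert hi] at hv
  have hvi : v i = 0 := by
    refine (injective_iff_map_eq_zero ((I.compProj V i J).app x).hom).1
      ((mono_iff_injective _).1 inferInstance x) _ ?_
    rw [compProj_apply, proj_eq_zero_iff]
    refine ⟨-v, ?_⟩
    rw [map_neg]
    exact (eq_neg_of_add_eq_zero_left hv).symm
  rw [hvi, map_zero, zero_add] at hv
  intro j hj
  rcases Finset.mem_insert.1 hj with rfl | hj
  · exact hvi
  · exact h x v hv j hj

theorem comp_cokerProj_insert_eq_zero {i : Fin d} (hi : i ∉ J) {U : CMod k C} (e : V ⟶ U) [Epi e]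
    (m : U ⟶ I.coker J V) (h : e ≫ m = I.compProj V i J) :
    m ≫ I.cokerProj V (Finset.subset_insert i J) = 0 := by
  rw [← cancel_epi e, ← Category.assoc, h, comp_zero, compProj_cokerProj, hom_eq_zero_iff]
  intro x v
  rw [compProj_apply, proj_eq_zero_iff]
  refine ⟨Function.update 0 i v, ?_⟩
  rw [sumMap_insert hi, sumMap_update hi, Function.update_self, map_zero, add_zero]

/-- Here `U` is the image of `θ_i` modulo the components in `J`. Allowing any epi-mono factorization
covers both uses: `U = V` for free modules, and a proper quotient of `V` when `θ_i` is not injective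
modulo `J`. -/
theorem shortExact_insert {i : Fin d} (hi : i ∉ J) {U : CMod k C} (e : V ⟶ U) [Epi e]
    (m : U ⟶ I.coker J V) [Mono m] (h : e ≫ m = I.compProj V i J) :
    (ShortComplex.mk m (I.cokerProj V (Finset.subset_insert i J))
      (comp_cokerProj_insert_eq_zero hi e m h)).ShortExact := by
  refine shortExact_of_pointwise _ ((mono_iff_injective m).1 inferInstance) (fun x w => ?_)
    (fun x w hw => ?_)
  · obtain ⟨w, rfl⟩ := proj_surjective x w
    exact ⟨((I.proj J V).app x).hom w, rfl⟩
  · obtain ⟨w, rfl⟩ := proj_surjective x w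
    have hw' : ((I.proj (insert i J) V).app x).hom w = 0 := hw
    obtain ⟨v, rfl⟩ := (proj_eq_zero_iff _).1 hw'
    refine ⟨(e.app x).hom (v i), ?_⟩
    have h₁ : (m.app x).hom ((e.app x).hom (v i)) = ((I.compProj V i J).app x).hom (v i) := by
      rw [← h]
      rfl
    refine h₁.trans ?_
    rw [sumMap_insert hi, map_add, (proj_eq_zero_iff (I.sumMap J V x v)).2 ⟨_, rfl⟩, add_zero,
      compProj_apply]

end InductiveFunctor

namespace InductiveFunctor

/-! ### Comparison with the cokernel of `θ` -/

variable (I : InductiveFunctor k C d) (J : Finset (Fin d)) (V : CMod k C)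

theorem comp_cokernel_π (j : Fin d) : I.comp j V ≫ cokernel.π (I.theta V) = 0 := by
  rw [comp, Category.assoc, cokernel.condition, comp_zero]

/-- The projection of `FV / ∑_{j ∈ J} θ_j V` to the cokernel of `θ_V`. -/
def cokerToCokernel : I.coker J V ⟶ cokernel (I.theta V) :=
  (I.rangeSub J V).desc (cokernel.π (I.theta V)) (by
    rintro x _ ⟨v, rfl⟩
    rw [sumMap_apply, map_sum]
    exact Finset.sum_eq_zero fun j _ => (hom_eq_zero_iff _).1 (I.comp_cokernel_π V j) x (v j))

instance : Epi (I.cokerToCokernel J V) :=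
  have : Epi (I.proj J V ≫ I.cokerToCokernel J V) := inferInstanceAs (Epi (cokernel.π (I.theta V)))
  epi_of_epi (I.proj J V) _

theorem theta_proj_univ : I.theta V ≫ I.proj Finset.univ V = 0 := by
  classical
  refine biproduct.hom_ext' _ _ fun j => ?_
  rw [comp_zero, hom_eq_zero_iff]
  intro x v
  refine (proj_eq_zero_iff (((I.comp j V).app x).hom v)).2 ⟨Pi.single j v, ?_⟩
  rw [sumMap_apply, Finset.sum_eq_single j]
  · rw [Pi.single_eq_same]
  · intro i _ hi
    rw [Pi.single_eq_of_ne hi, map_zero]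
  · exact fun h => absurd (Finset.mem_univ j) h

/-- The projection of the cokernel of `θ_V` to `FV / ∑_j θ_j V`. -/
def cokernelToCoker : cokernel (I.theta V) ⟶ I.coker Finset.univ V :=
  cokernel.desc _ (I.proj Finset.univ V) (I.theta_proj_univ V)

instance : Epi (I.cokernelToCoker V) :=
  have : Epi (cokernel.π (I.theta V) ≫ I.cokernelToCoker V) := by
    rw [cokernelToCoker, cokernel.π_desc]
    infer_instance
  epi_of_epi (cokernel.π (I.theta V)) _

variable {I J V}

theorem genLT_cokernel_iff (hV : ¬ IsZero V) (n : ℕ) :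
    GenLT (cokernel (I.theta V)) n ↔ GenLT V (n + 1) := by
  have h : gd (cokernel (I.theta V)) = gd V - 1 := I.gd_cokernel V hV
  rw [← gd_le_sub_one_iff, h, sub_one_le_sub_one_iff, gd_le_natCast_iff]

/-- Whatever `J` is, `I.coker J V` surjects onto the cokernel of `θ_V`, whose generating degree
determines that of `V`. -/
theorem genLT_succ_of_coker {n : ℕ} (h : GenLT (I.coker J V) n) : GenLT V (n + 1) := by
  by_cases hV : IsZero V
  · exact .of_isZero hV _
  · exact (genLT_cokernel_iff hV n).1 (h.of_epi (I.cokerToCokernel J V))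

/-- Generation passes to quotients, so an epimorphism from the cokernel of `θ_V` suffices. The zero
module is separate because the degree formula concerns nonzero modules. -/
theorem genLT_coker_univ {n : ℕ} (h : GenLT V (n + 1)) : GenLT (I.coker Finset.univ V) n := by
  by_cases hV : IsZero V
  · have : IsZero (I.F.obj V) := I.F.map_isZero hV
    exact GenLT.of_epi (.of_isZero this n) (I.proj _ V)
  · exact ((genLT_cokernel_iff hV n).2 h).of_epi (I.cokernelToCoker V)

/-! ### Finite direct sums of free modules under an inductive functor -/

section FinFree

variable {n : ℕ} {P : CMod k C}

theorem good_of_isFinFree (h : IsFinFree n P) : I.Good J P := by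
  induction h with
  | zero => exact .of_isZero (isZero_zero _)
  | add x _ _ ih => exact .of_shortExact (shortExact_biprod _ _) ih (good_freeMod x)

theorem isFG_map_of_isFinFree (h : IsFinFree n P) : IsFG (I.F.obj P) := by
  induction h with
  | zero => exact .of_isZero (I.F.map_isZero (isZero_zero _))
  | add x _ _ ih =>
    exact .of_shortExact ((shortExact_biprod _ _).map_of_exact I.F) ih (I.isFG_free x)

theorem isFG_map (hV : IsFG V) (h : GenLT V n) : IsFG (I.F.obj V) := by
  obtain ⟨P, f, hP, _⟩ := hV.exists_isFinFree h
  exact (isFG_map_of_isFinFree hP).of_epi (I.F.map f)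

/-- Descending from the full index set to `J`, each removal of an index `i` is an extension whose
kernel is the image of `V` under `θ_i`, to which `hQ` applies. -/
theorem exists_extVanish_coker (hJ : ∀ i ∉ J, ¬ Mono (I.compProj V i J))
    (hQ : ∀ (U : CMod k C) (e : V ⟶ U), Epi e → ¬ Mono e → ∃ c, ExtVanish U c)
    (hR : ∃ c, ExtVanish (I.coker Finset.univ V) c) : ∃ c, ExtVanish (I.coker J V) c := by
  classical
  suffices H : ∀ K : Finset (Fin d), J ⊆ Kᶜ → ∃ c, ExtVanish (I.coker Kᶜ V) c by
    simpa using H Jᶜ (by simp)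
  intro K
  induction K using Finset.induction_on with
  | empty => simpa using hR
  | insert i K hi ih =>
    intro hK
    have hiK : i ∉ (insert i K)ᶜ := by simp
    have hins : insert i (insert i K)ᶜ = Kᶜ := by
      rw [Finset.compl_insert, Finset.insert_erase (Finset.mem_compl.2 hi)]
    obtain ⟨c, hc⟩ := ih (hK.trans (hins ▸ Finset.subset_insert _ _))
    rw [← hins] at hc
    let ρ := I.compProj V i (insert i K)ᶜ
    let m : (SubMod.ker ρ).quot ⟶ I.coker (insert i K)ᶜ V := (SubMod.ker ρ).desc ρ fun x v hv => hv
    have hm : Mono m := (mono_iff_injective _).2 fun x =>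
      (injective_iff_map_eq_zero (m.app x).hom).2 fun w hw => by
        obtain ⟨v, rfl⟩ := (SubMod.ker ρ).π_surjective x w
        exact ((SubMod.ker ρ).π_eq_zero_iff v).2 hw
    -- The map `ρ` factors through `I.compProj V i J` because `J` is contained in the current index
    -- set; if `ρ` were injective, so would be that map.
    obtain ⟨c', hc'⟩ := hQ _ (SubMod.ker ρ).π inferInstance fun he => by
      have : Mono (I.compProj V i J ≫ I.cokerProj V hK) :=
        mono_comp (SubMod.ker ρ).π m
      exact hJ i (fun h => hiK (hK h)) (mono_of_mono _ (I.cokerProj V hK))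
    refine ⟨max c c', ExtVanish.middle (shortExact_insert hiK (SubMod.ker ρ).π m rfl)
      (hc'.mono (le_max_right _ _)) (hc.mono (le_max_left _ _))⟩

theorem extVanish_map_of_isFinFree
    (hF : ∀ x : C, ExtVanish (I.F.obj (freeMod k x)) (rank x + 1))
    (h : IsFinFree n P) : ExtVanish (I.F.obj P) n := by
  induction h with
  | zero => exact .of_isZero (I.F.map_isZero (isZero_zero _)) n
  | add x hx _ ih =>
    exact ExtVanish.middle ((shortExact_biprod _ _).map_of_exact I.F) ih ((hF x).mono hx)

/-- For free modules every component stays injective modulo the others, so each new index divides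
out a copy of `P` and the bound `n` persists. -/
theorem extVanish_coker_of_isFinFree
    (hF : ∀ x : C, ExtVanish (I.F.obj (freeMod k x)) (rank x + 1))
    (h : IsFinFree n P) (J : Finset (Fin d)) :
    ExtVanish (I.coker J P) n := by
  classical
  induction J using Finset.induction_on with
  | empty =>
    have : Mono (I.proj ∅ P) := (mono_iff_injective _).2 fun x =>
      (injective_iff_map_eq_zero ((I.proj ∅ P).app x).hom).2 fun w hw => by
        obtain ⟨v, rfl⟩ := (proj_eq_zero_iff _).1 hw
        rw [sumMap_apply, Finset.sum_empty]
    have : IsIso (I.proj ∅ P) := isIso_of_mono_of_epi _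
    exact (extVanish_map_of_isFinFree hF h).of_iso (asIso (I.proj ∅ P))
  | insert i J hi ih =>
    have := Good.mono_compProj hi (good_of_isFinFree (I := I) h)
    exact ExtVanish.right (shortExact_insert hi (𝟙 P) _ (Category.id_comp _)) h.extVanish ih

/-! ### The inductive machinery -/

/-- Induction on the degree of Ext, passing from `V` to the kernel of a finite free cover and from
`c` to `c + 1`. The bound on `coker` is what limits the generating degree of that kernel. -/
theorem ext_eq_zero_of_good
    (hF : ∀ x : C, ExtVanish (I.F.obj (freeMod k x)) (rank x + 1))
    (hN : LocallyNoetherian k C) (J : Finset (Fin d)) (i : ℕ) :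
    ∀ (V : CMod k C) (c : ℕ), IsFG V → I.Good J V → ExtVanish (I.coker J V) c → GenLT V (c + 1) →
      ∀ S : CMod k C, VanishLT S (c + 1 + i) → ∀ e : Abelian.Ext V S i, e = 0 := by
  induction i with
  | zero => exact fun V c _ _ _ hg S hS => hg.ext_zero_eq_zero hS
  | succ i ih =>
    intro V c hV hJ hR hg S hS
    obtain ⟨P, f, hP, _⟩ := hV.exists_isFinFree hg
    have hPp := hP.projective
    have hSES := shortExact_kernel f
    have hZ : ExtVanish (I.coker J (kernel f)) (c + 1) :=
      ExtVanish.left (shortExact_coker hSES hJ) (extVanish_coker_of_isFinFree hF hP J) hR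
    refine ext_succ_eq_zero hSES (ih (kernel f) (c + 1) (hN P hP.isFG _ (kernel.ι f))
      ((good_of_isFinFree hP).of_mono (kernel.ι f)) hZ (genLT_succ_of_coker hZ.genLT) S
      (hS.mono (by omega))) Abelian.Ext.eq_zero_of_projective

theorem exists_extVanish_of_good
    (hF : ∀ x : C, ExtVanish (I.F.obj (freeMod k x)) (rank x + 1))
    (hN : LocallyNoetherian k C) (hV : IsFG V) (hJ : I.Good J V)
    {c : ℕ} (hR : ExtVanish (I.coker J V) c) : ∃ c, ExtVanish V c :=
  ⟨c + 1, fun i => ext_eq_zero_of_good hF hN J i V c hV hJ hR (genLT_succ_of_coker hR.genLT)⟩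

theorem exists_extVanish
    (hF : ∀ x : C, ExtVanish (I.F.obj (freeMod k x)) (rank x + 1))
    (hN : LocallyNoetherian k C) (n : ℕ) :
    ∀ V : CMod k C, IsFG V → GenLT V n → ∃ c, ExtVanish V c := by
  classical
  induction n with
  | zero => exact fun V _ h => ⟨0, .of_isZero (genLT_zero_iff.1 h) 0⟩
  | succ n ih =>
    intro V hV hg
    have := wellFoundedGT_subMod hN hV
    -- Quotients of the fixed module `V` are indexed by their kernels, ordered by inclusion; larger
    -- kernels come first.
    suffices H : ∀ (N : SubMod V) (W : CMod k C) (f : V ⟶ W), Epi f → SubMod.ker f = N →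
        ∃ c, ExtVanish W c from H _ V (𝟙 V) inferInstance rfl
    intro N
    induction N using WellFoundedGT.induction with
    | ind N ihN =>
      rintro W f hf rfl
      have hW := hV.of_epi f
      have hgW := hg.of_epi f
      -- The empty set satisfies the condition vacuously; then `I.coker ∅ W` is just `FW`.
      obtain ⟨J, hJ⟩ := (Set.toFinite {J | I.Good J W}).exists_maximal
        ⟨∅, fun x v _ j hj => absurd hj (Finset.notMem_empty j)⟩
      have hmax (i : Fin d) (hi : i ∉ J) : ¬ Mono (I.compProj W i J) := fun _ =>
        hi (hJ.2 (Good.insert hi hJ.1) (Finset.subset_insert i J) (Finset.mem_insert_self i J))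
      have hquot (U : CMod k C) (e : W ⟶ U) (_ : Epi e) (hm : ¬ Mono e) : ∃ c, ExtVanish U c := by
        -- A quotient map that is not injective strictly enlarges the kernel of `V ⟶ W ⟶ U`.
        refine ihN (SubMod.ker (f ≫ e)) (lt_of_le_not_ge (fun x v hv => ?_) fun hle => hm ?_) U
          (f ≫ e) inferInstance rfl
        · change (e.app x).hom ((f.app x).hom v) = 0
          rw [(SubMod.mem_ker f v).1 hv, map_zero]
        · refine (mono_iff_injective e).2 fun x =>
            (injective_iff_map_eq_zero (e.app x).hom).2 fun w hw => ?_
          obtain ⟨v, rfl⟩ := (epi_iff_surjective f).1 hf x w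
          exact hle x hw
      -- The outer induction applies to the quotient by all components: it is generated in ranks `<
      -- n`, and finitely generated as a quotient of `FW`.
      obtain ⟨c, hc⟩ := exists_extVanish_coker hmax hquot
        (ih _ ((isFG_map hW hgW).of_epi (I.proj _ W)) (genLT_coker_univ hgW))
      exact exists_extVanish_of_good hF hN hW hJ.1 hc

end FinFree

end InductiveFunctor

theorem IsFG.exists_genLT {V : CMod k C} (hV : IsFG V) : ∃ n, GenLT V n := by
  obtain ⟨S, hS, h⟩ := isFG_iff.1 hV
  obtain ⟨n, hn⟩ := (hS.image fun s => rank s.1).bddAbove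
  exact ⟨n + 1, fun U hU f => h U f fun s hs =>
    hU.eq_zero (Nat.lt_succ_of_le (hn ⟨s, hs, rfl⟩)) _⟩

end

end GradedCategory

theorem theorem1p2 (k : Type u) [CommRing k] [IsNoetherianRing k]
    (C : Type u) [SmallCategory C] [GradedCategory C]
    (d : ℕ) (I : GradedCategory.InductiveFunctor k C d)
    (hN : GradedCategory.LocallyNoetherian k C)
    (hreg : ∀ x : C,
      GradedCategory.reg (I.F.obj (GradedCategory.freeMod k x)) ≤ (GradedCategory.rank x : EReal))
    (V : GradedCategory.CMod k C) (hV : GradedCategory.IsFG V) :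
    GradedCategory.reg V < ⊤ := by
  obtain ⟨n, hn⟩ := hV.exists_genLT
  obtain ⟨c, hc⟩ := GradedCategory.InductiveFunctor.exists_extVanish
    (fun x => GradedCategory.extVanish_of_reg_le (hreg x)) hN n V hV hn
  exact hc.reg_lt_top
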